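/- Let $F$ be a probability distribution on $[0,1]$ (a buyer's value distribution) with $F(\{0\})=0$; write $F$ also for its CDF and $F^-(t)=\inf\{x\in[0,1] : F(x)\ge t\}$, and let $\lambda$ be Lebesgue measure. A bidding strategy is a Markov kernel $s$ from $[0,1]$ (values) to $[0,1]$ (bids); let $\mathcal S$ be the set of all of them. For a distribution $H\in\Delta([0,1])$ of the highest competing bid, independent of values and bids, let $$U_F(s,H)=\mathbb E_{(v,h)\sim F\times H}\,\mathbb E_{b\sim s(v)}\big[(v-b)\,\mathbf 1\{b\ge h\}\big],\qquad \mathrm{Reg}_F(s,H)=\sup_{s'\in\mathcal S}U_F(s',H)-U_F(s,H),$$ and for $\mathcal H\in\Delta(\Delta([0,1]))$ let $\mathrm{Reg}_F(s,\mathcal H)=\mathbb E_{H\sim\mathcal H}[\mathrm{Reg}_F(s,H)]$. For a strictly increasing, absolutely continuous $Q:[0,1]\to[0,1]$ and $Y(v)=\{y\in[0,1] : F^-(y)=v\}$, let $s_Q\in\mathcal S$ be the strategy that bids $Q(F(v))$ at value $v$ if $\lambda(Y(v))=F(\{v\})=0$, and bids $Q(y)$ with $y$ uniform on $Y(v)$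 otherwise. Then there is a strictly increasing, absolutely continuous $Q^*:[0,1]\to[0,1]$ with $Q^*(0)=0$, with $0<Q^*(y)<F^-(y)$ for all $y\in(0,1]$, and with $$(Q^*)'(y)=\frac{F^-(y)-Q^*(y)}{1-F(Q^*(y))}\quad\text{for almost every } y\in[0,1].$$ For every such $Q^*$ there is a (unique) distribution $H^*\in\Delta([0,1])$ with CDF $$H^*(x)=\exp\Big(-\int_{(Q^*)^{-1}(x)}^1\frac{dt}{1-F(Q^*(t))}\Big),\qquad x\in[0,Q^*(1)],$$ and if $\mathcal H^*$ denotes the distribution of the Dirac distribution $\delta_h$ for $h\sim H^*$, then $(s_{Q^*},\mathcal H^*)$ is a saddle point of the partial-information regret: for all $s\in\mathcal S$, $H\in\Delta([0,1])$ and $\mathcal H\in\Delta(\Delta([0,1]))$, $$\mathrm{Reg}_F(s_{Q^*},\mathcal H^*)\le \mathrm{Reg}_F(s,\mathcal H^*),\qquad \mathrm{Reg}_F(s_{Q^*},H)\le \mathrm{Reg}_F(s_{Q^*},\mathcal H^*),\qquad \mathrm{Reg}_F(s_{Q^*},\mathcal H)\le \mathrm{Reg}_F(s_{Q^*},\mathcal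 H^*).$$ Moreover $$\inf_{s\in\mathcal S}\ \sup_{H\in\Delta([0,1])}\mathrm{Reg}_F(s,H)=\mathrm{Reg}_F(s_{Q^*},\mathcal H^*)=\int_0^1Q^*(t)\,dt,$$ and $s_{Q^*}$ is minimax optimal: $\sup_H\mathrm{Reg}_F(s_{Q^*},H)\le\sup_H\mathrm{Reg}_F(s,H)$ for every $s\in\mathcal S$. -/

import Mathlib

open MeasureTheory ProbabilityTheory unitInterval

namespace FirstPrice

noncomputable section

/-! ### Bidding strategies, utility and regret -/

/-- A bidding strategy is a Markov kernel from values in `[0,1]` to bids in `[0,1]`. -/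
abbrev Strategy : Type := {s : Kernel I I // IsMarkovKernel s}

instance (s : Strategy) : IsMarkovKernel s.1 := s.2

/-- Ex-post utility `(v - b) 1{b ≥ h}` of the bid `b` against the highest competing bid `h`. -/
def utility (b h v : I) : ℝ := if h ≤ b then (v : ℝ) - b else 0

/-- Expected utility of the strategy `s` for the value distribution `F` and the distribution `H`
of the highest competing bid. -/
def expectedUtility (F : ProbabilityMeasure I) (s : Strategy) (H : ProbabilityMeasure I) : ℝ :=
  ∫ p : I × I, (∫ b, utility b p.2 p.1 ∂(s.1 p.1)) ∂((F : Measure I).prod (H : Measure I))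

/-- Regret against the optimal utility attainable with knowledge of `H`. -/
def regret (F : ProbabilityMeasure I) (s : Strategy) (H : ProbabilityMeasure I) : ℝ :=
  (⨆ s' : Strategy, expectedUtility F s' H) - expectedUtility F s H

/-- Worst-case regret over all distributions of the highest competing bid. -/
def worstRegret (F : ProbabilityMeasure I) (s : Strategy) : ℝ :=
  ⨆ H : ProbabilityMeasure I, regret F s H

/-- Expected regret when the distribution `H` is itself drawn from a distribution `𝓗`. -/
def mixedRegret (F : ProbabilityMeasure I) (s : Strategy)
    (𝓗 : ProbabilityMeasure (ProbabilityMeasure I)) : ℝ :=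
  ∫ H, regret F s H ∂(𝓗 : Measure (ProbabilityMeasure I))

/-- A minimax-optimal strategy attains the smallest worst-case regret. -/
def IsMinimaxOptimal (F : ProbabilityMeasure I) (s : Strategy) : Prop :=
  ∀ s' : Strategy, worstRegret F s ≤ worstRegret F s'

theorem measurable_diracProba' : Measurable (fun h : I => diracProba h) :=
  Measurable.subtype_mk Measure.measurable_dirac

/-- The distribution of the Dirac distribution `δ_h` when `h` has distribution `H`. -/
def diracMixture (H : ProbabilityMeasure I) : ProbabilityMeasure (ProbabilityMeasure I) :=
  H.map measurable_diracProba'.aemeasurable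

/-! The suprema and infima of reals above are over nonempty bounded sets. -/

theorem abs_utility_le_one (b h v : I) : |utility b h v| ≤ 1 := by
  unfold utility
  split_ifs
  · rw [abs_le]
    constructor <;> linarith [v.2.1, v.2.2, b.2.1, b.2.2]
  · simp

theorem abs_expectedUtility_le_one (F : ProbabilityMeasure I) (s : Strategy)
    (H : ProbabilityMeasure I) : |expectedUtility F s H| ≤ 1 := by
  have h := norm_integral_le_of_norm_le_const
    (μ := (F : Measure I).prod (H : Measure I)) (C := 1)
    (f := fun p : I × I => ∫ b, utility b p.2 p.1 ∂(s.1 p.1))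
    (Filter.Eventually.of_forall fun p => by
      have h' := norm_integral_le_of_norm_le_const (μ := s.1 p.1) (C := 1)
        (f := fun b => utility b p.2 p.1)
        (Filter.Eventually.of_forall fun b => abs_utility_le_one b p.2 p.1)
      simpa using h')
  simpa [expectedUtility] using h

theorem bddAbove_expectedUtility (F H : ProbabilityMeasure I) :
    BddAbove (Set.range fun s : Strategy => expectedUtility F s H) :=
  ⟨1, by rintro _ ⟨s, rfl⟩; exact (abs_le.1 (abs_expectedUtility_le_one F s H)).2⟩

theorem regret_nonneg (F : ProbabilityMeasure I) (s : Strategy) (H : ProbabilityMeasure I) :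
    0 ≤ regret F s H :=
  sub_nonneg.2 (le_ciSup (bddAbove_expectedUtility F H) s)

theorem regret_le_two (F : ProbabilityMeasure I) (s : Strategy) (H : ProbabilityMeasure I) :
    regret F s H ≤ 2 := by
  have : Nonempty Strategy := ⟨s⟩
  have h1 : (⨆ s' : Strategy, expectedUtility F s' H) ≤ 1 :=
    ciSup_le fun s' => (abs_le.1 (abs_expectedUtility_le_one F s' H)).2
  have h2 := (abs_le.1 (abs_expectedUtility_le_one F s H)).1
  unfold regret
  linarith

theorem bddAbove_regret (F : ProbabilityMeasure I) (s : Strategy) :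
    BddAbove (Set.range fun H : ProbabilityMeasure I => regret F s H) :=
  ⟨2, by rintro _ ⟨H, rfl⟩; exact regret_le_two F s H⟩

theorem bddBelow_worstRegret (F : ProbabilityMeasure I) :
    BddBelow (Set.range fun s : Strategy => worstRegret F s) :=
  ⟨0, by rintro _ ⟨s, rfl⟩; exact Real.iSup_nonneg fun H => regret_nonneg F s H⟩

/-! ### Quantile-based strategies -/

/-- Cumulative distribution function of a distribution on `[0,1]`. -/
def cdf (F : ProbabilityMeasure I) (x : ℝ) : ℝ :=
  ProbabilityTheory.cdf ((F : Measure I).map ((↑) : I → ℝ)) x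

/-- Generalized inverse `inf {x ∈ [0,1] | F x ≥ t}` of the cumulative distribution function. -/
def quantile (F : ProbabilityMeasure I) (t : ℝ) : ℝ :=
  sInf {x : ℝ | x ∈ Set.Icc (0 : ℝ) 1 ∧ t ≤ cdf F x}

/-- The values of the cumulative distribution function as points of `[0,1]`. -/
def cdfI (F : ProbabilityMeasure I) (v : I) : I :=
  ⟨cdf F v, cdf_nonneg _ _, cdf_le_one _ _⟩

theorem monotone_cdfI (F : ProbabilityMeasure I) : Monotone (cdfI F) :=
  fun _ _ h => monotone_cdf _ h

theorem monotone_quantile (F : ProbabilityMeasure I) :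
    Monotone (fun y : I => quantile F (y : ℝ)) := by
  intro a b hab
  have : IsProbabilityMeasure ((F : Measure I).map ((↑) : I → ℝ)) :=
    Measure.isProbabilityMeasure_map measurable_subtype_coe.aemeasurable
  have h1 : cdf F 1 = 1 := by
    have hset : ((↑) : I → ℝ) ⁻¹' Set.Iic 1 = Set.univ := by
      ext x; simpa using x.2.2
    rw [cdf, ProbabilityTheory.cdf_eq_real, Measure.real,
      Measure.map_apply measurable_subtype_coe measurableSet_Iic, hset]
    simp
  refine csInf_le_csInf ⟨0, fun x hx => hx.1.1⟩ ⟨1, ⟨by simp, ?_⟩⟩ ?_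
  · rw [h1]; exact b.2.2
  · exact fun x hx => ⟨hx.1, le_trans hab hx.2⟩

/-- The set of quantiles that correspond to the value `v`. -/
def quantileSet (F : ProbabilityMeasure I) (v : I) : Set I :=
  {y : I | quantile F (y : ℝ) = v}

theorem measurableSet_quantileSet (F : ProbabilityMeasure I) (v : I) :
    MeasurableSet (quantileSet F v) :=
  (monotone_quantile F).measurable (measurableSet_singleton (v : ℝ))

/-- The extension of `Q : [0,1] → [0,1]` to a real function that is constant on each side of
`[0,1]`. -/
def extend (Q : I → I) (t : ℝ) : ℝ := Q (Set.projIcc 0 1 zero_le_one t)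

/-- Strictly increasing, absolutely continuous functions `[0,1] → [0,1]`. -/
structure QuantileStrategy where
  toFun : I → I
  strictMono : StrictMono toFun
  absCont : AbsolutelyContinuousOnInterval (extend toFun) 0 1

instance : CoeFun QuantileStrategy (fun _ => I → I) := ⟨QuantileStrategy.toFun⟩

theorem QuantileStrategy.measurable (Q : QuantileStrategy) : Measurable Q :=
  Q.strictMono.monotone.measurable

open Classical in
/-- The bid distribution for the value `v`: the bid `Q (F v)` if `λ (Y v) = F {v} = 0`, where `Y v`
is the set of quantiles of `v`, and otherwise the bid `Q y` with `y` uniform on `Y v`. -/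
def quantileBid (F : ProbabilityMeasure I) (Q : QuantileStrategy) (v : I) : Measure I :=
  if (volume : Measure I) (quantileSet F v) = 0 then Measure.dirac (Q (cdfI F v))
  else (ProbabilityTheory.cond (volume : Measure I) (quantileSet F v)).map Q

theorem isProbabilityMeasure_quantileBid (F : ProbabilityMeasure I) (Q : QuantileStrategy)
    (v : I) : IsProbabilityMeasure (quantileBid F Q v) := by
  unfold quantileBid
  split_ifs with h
  · infer_instance
  · have := cond_isProbabilityMeasure (μ := (volume : Measure I)) h
    exact Measure.isProbabilityMeasure_map Q.measurable.aemeasurable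

theorem measurable_quantileBid (F : ProbabilityMeasure I) (Q : QuantileStrategy) :
    Measurable (quantileBid F Q) := by
  have h1 : Measurable (fun v : I => Measure.dirac (Q (cdfI F v))) :=
    Measure.measurable_dirac.comp (Q.measurable.comp (monotone_cdfI F).measurable)
  refine h1.measurable_of_countable_ne ?_
  have hc : {v : I | 0 < (volume : Measure I) (quantileSet F v)}.Countable :=
    Measure.countable_meas_pos_of_disjoint_iUnion (measurableSet_quantileSet F) (by
      intro v w hvw
      refine Set.disjoint_left.2 fun y hy hy' => hvw (Subtype.ext ?_)
      exact (show quantile F (y : ℝ) = v from hy).symm.trans hy')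
  refine Set.Countable.mono ?_ hc
  intro v hv
  by_contra h
  have h0 : (volume : Measure I) (quantileSet F v) = 0 := by simpa using h
  exact hv (by simp [quantileBid, h0])

/-- The bidding strategy that corresponds to the quantile-based strategy `Q`. -/
def QuantileStrategy.toStrategy (Q : QuantileStrategy) (F : ProbabilityMeasure I) : Strategy :=
  ⟨⟨quantileBid F Q, measurable_quantileBid F Q⟩, ⟨isProbabilityMeasure_quantileBid F Q⟩⟩

/-! ### The candidate saddle point -/

/-- `Q` solves `Q' = (F⁻ - Q) / (1 - F ∘ Q)`, `Q 0 = 0`, almost everywhere on `[0,1]`, and lies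
strictly between `0` and `F⁻` on `(0,1]`. -/
structure IsOptimalQuantile (F : ProbabilityMeasure I) (Q : QuantileStrategy) : Prop where
  ode : ∀ᵐ t ∂(volume.restrict (Set.Icc (0 : ℝ) 1)),
    HasDerivAt (extend Q) ((quantile F t - extend Q t) / (1 - cdf F (extend Q t))) t
  zero : Q 0 = 0
  pos : ∀ y : I, 0 < y → 0 < Q y
  lt : ∀ y : I, 0 < y → (Q y : ℝ) < quantile F y

/-- `H` has the cumulative distribution function
`x ↦ exp (- ∫ t in Q⁻¹ x..1, 1 / (1 - F (Q t)))` on `[0, Q 1]`. Its value at `Q 1` is `1`, so this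
determines `H`. -/
def IsOptimalCompetingBid (F : ProbabilityMeasure I) (Q : QuantileStrategy)
    (H : ProbabilityMeasure I) : Prop :=
  ∀ x : I, x ≤ Q 1 →
    cdf H x = Real.exp (-∫ t in ((Function.invFun Q.toFun x : I) : ℝ)..1, 1 / (1 - cdf F (extend Q t)))

end

end FirstPrice

open MeasureTheory ProbabilityTheory unitInterval Set Filter Topology

namespace FirstPrice

noncomputable section

/-! ### Cumulative distribution functions and quantiles -/

/-! Write S(x) = ∫₀ˣ (1 - F) (`surplus`). Against a known competing bid h the best attainable
utility is E(v - h)⁺ = S(1) - S(h). If Y is uniform, a quantile strategy Q produces the value-bid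
pair (F⁻(Y), Q(Y)) (`integral_toStrategy`), so against h = Q(y) it earns ∫_y^1 (F⁻ - Q).

The differential equation says exactly that (S ∘ Q)' = F⁻ - Q. This payoff is therefore S(Q 1) - S(Q
y), and the regret is S(1) - S(Q 1) = ∫ Q for every h ≤ Q 1; larger h give no more. Knowing h is
worth at least as much as knowing only its law, so ∫ Q bounds the regret against every H
(`regret_le`).

In the other direction, H* makes Q a best response. With W = H* ∘ Q, the derivative of (v - Q) W is
a positive multiple of v - F⁻, so a buyer with value v = F⁻(y) maximizes expected utility at the bid
Q(y) (`sub_mul_winProb_le`). In the regret against the Dirac mixture the benchmark does not depend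
on the strategy, so a best response minimizes it. The two halves form a saddle point, which yields
the minimax value and optimality.

For existence, z = S ∘ Q turns the equation into z' = F⁻ - S⁻¹(z). Two obstacles arise: F⁻ may jump,
and S⁻¹ need not be Lipschitz where F approaches 1. Subtracting ∫ F⁻ from z leaves a continuous
vector field for Picard-Lindelöf; capping F at some c < 1 makes the inverse Lipschitz. An a priori
bound on z(1) (`add_sq_div_le`) shows that the solution never reaches the region where the cap acts,
and a first-contact argument (`comp_lt`) gives Q < F⁻. -/

theorem cdf_eq_measureReal (F : ProbabilityMeasure I) (x : ℝ) :
    cdf F x = (F : Measure I).real {v : I | (v : ℝ) ≤ x} := by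
  have : IsProbabilityMeasure ((F : Measure I).map ((↑) : I → ℝ)) :=
    Measure.isProbabilityMeasure_map measurable_subtype_coe.aemeasurable
  rw [cdf, ProbabilityTheory.cdf_eq_real, map_measureReal_apply measurable_subtype_coe
    measurableSet_Iic]
  rfl

theorem monotone_cdf' (F : ProbabilityMeasure I) : Monotone (cdf F) := monotone_cdf _

theorem cdf_nonneg' (F : ProbabilityMeasure I) (x : ℝ) : 0 ≤ cdf F x := cdf_nonneg _ _

theorem cdf_le_one' (F : ProbabilityMeasure I) (x : ℝ) : cdf F x ≤ 1 := cdf_le_one _ _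

theorem cdf_eq_one (F : ProbabilityMeasure I) {x : ℝ} (hx : 1 ≤ x) : cdf F x = 1 := by
  have : {v : I | (v : ℝ) ≤ x} = univ := by
    ext v; simpa using v.2.2.trans hx
  rw [cdf_eq_measureReal, this]
  simp

theorem cdf_zero {F : ProbabilityMeasure I} (hF : (F : Measure I) {0} = 0) : cdf F 0 = 0 := by
  have : {v : I | (v : ℝ) ≤ 0} = {0} := by
    ext v
    simp only [mem_ofPred_eq, mem_singleton_iff]
    exact ⟨fun h => Subtype.ext (le_antisymm h v.2.1), fun h => by simp [h]⟩
  rw [cdf_eq_measureReal, this, measureReal_def, hF]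
  simp

theorem measurable_cdf (F : ProbabilityMeasure I) : Measurable (cdf F) :=
  (monotone_cdf' F).measurable

theorem continuousWithinAt_cdf (F : ProbabilityMeasure I) (x : ℝ) :
    ContinuousWithinAt (cdf F) (Ici x) x :=
  (ProbabilityTheory.cdf ((F : Measure I).map ((↑) : I → ℝ))).right_continuous x

/-- Right-continuity of the CDF makes the infimum attained, so quantile and CDF form a Galois
connection. -/
theorem quantile_le_iff (F : ProbabilityMeasure I) {t x : ℝ} (ht : t ≤ 1) (hx : x ∈ Icc (0 : ℝ) 1) :
    quantile F t ≤ x ↔ t ≤ cdf F x := by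
  refine ⟨fun h => ?_, fun h => csInf_le ⟨0, fun y hy => hy.1.1⟩ ⟨hx, h⟩⟩
  have hc : Tendsto (cdf F) (𝓝[>] x) (𝓝 (cdf F x)) :=
    (continuousWithinAt_cdf F x).tendsto.mono_left (nhdsWithin_mono _ Ioi_subset_Ici_self)
  refine ge_of_tendsto hc ?_
  filter_upwards [self_mem_nhdsWithin] with y hy
  obtain ⟨z, hz, hzy⟩ := exists_lt_of_csInf_lt
    (s := {x : ℝ | x ∈ Icc (0 : ℝ) 1 ∧ t ≤ cdf F x})
    ⟨1, by simp, by rwa [cdf_eq_one F le_rfl]⟩ (h.trans_lt hy)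
  exact hz.2.trans (monotone_cdf' F hzy.le)

theorem lt_quantile_iff (F : ProbabilityMeasure I) {t x : ℝ} (ht : t ≤ 1)
    (hx : x ∈ Icc (0 : ℝ) 1) : x < quantile F t ↔ cdf F x < t := by
  rw [← not_le, quantile_le_iff F ht hx, not_le]

theorem quantile_nonneg (F : ProbabilityMeasure I) (t : ℝ) : 0 ≤ quantile F t :=
  Real.sInf_nonneg fun _ hx => hx.1.1

theorem quantile_le_one (F : ProbabilityMeasure I) {t : ℝ} (ht : t ≤ 1) : quantile F t ≤ 1 :=
  (quantile_le_iff F ht (by simp)).2 (by rwa [cdf_eq_one F le_rfl])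

theorem le_cdf_quantile (F : ProbabilityMeasure I) {t : ℝ} (ht : t ≤ 1) :
    t ≤ cdf F (quantile F t) :=
  (quantile_le_iff F ht ⟨quantile_nonneg F t, quantile_le_one F ht⟩).1 le_rfl

theorem quantile_mono (F : ProbabilityMeasure I) {s t : ℝ} (h : s ≤ t) (ht : t ≤ 1) :
    quantile F s ≤ quantile F t :=
  (quantile_le_iff F (h.trans ht) ⟨quantile_nonneg F t, quantile_le_one F ht⟩).2
    (h.trans (le_cdf_quantile F ht))

theorem quantile_zero (F : ProbabilityMeasure I) : quantile F 0 = 0 :=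
  le_antisymm ((quantile_le_iff F zero_le_one (by simp)).2 (cdf_nonneg' F 0)) (quantile_nonneg F 0)

theorem quantile_pos {F : ProbabilityMeasure I} (hF : (F : Measure I) {0} = 0) {t : ℝ}
    (h0 : 0 < t) (ht : t ≤ 1) : 0 < quantile F t :=
  (lt_quantile_iff F ht (by simp)).2 (by rwa [cdf_zero hF])

/-- The quantile function as a map `[0,1] → [0,1]`. -/
def quantileI (F : ProbabilityMeasure I) (y : I) : I :=
  ⟨quantile F y, quantile_nonneg F y, quantile_le_one F y.2.2⟩

theorem monotone_quantileI (F : ProbabilityMeasure I) : Monotone (quantileI F) :=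
  fun _ b h => quantile_mono F h b.2.2

theorem measurable_quantileI (F : ProbabilityMeasure I) : Measurable (quantileI F) :=
  (monotone_quantileI F).measurable

/-- Inverse transform sampling: by the Galois connection, the preimage of an initial segment is the
initial segment of length F(x). -/
theorem map_quantileI (F : ProbabilityMeasure I) :
    (volume : Measure I).map (quantileI F) = (F : Measure I) := by
  have := Measure.isProbabilityMeasure_map (μ := (volume : Measure I))
    (measurable_quantileI F).aemeasurable
  refine Measure.ext_of_Iic _ _ fun x => ?_
  rw [Measure.map_apply (measurable_quantileI F) measurableSet_Iic]
  have h1 : quantileI F ⁻¹' Iic x = Iic (cdfI F x) := by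
    ext y
    exact quantile_le_iff F y.2.2 x.2
  have h2 : (F : Measure I) (Iic x) = ENNReal.ofReal (cdf F x) := by
    rw [cdf_eq_measureReal, ofReal_measureReal]
    rfl
  rw [h1, h2, unitInterval.volume_Iic]
  rfl

theorem integral_quantileI (F : ProbabilityMeasure I) {f : I → ℝ} (hf : Measurable f) :
    ∫ v, f v ∂(F : Measure I) = ∫ y, f (quantileI F y) := by
  rw [← map_quantileI F, integral_map (measurable_quantileI F).aemeasurable
    hf.aestronglyMeasurable]

theorem integral_unitInterval_eq (f : ℝ → ℝ) : ∫ y : I, f y = ∫ t in (0 : ℝ)..1, f t := by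
  rw [intervalIntegral.integral_of_le zero_le_one, ← integral_Icc_eq_integral_Ioc]
  exact integral_subtype measurableSet_Icc f

/-- The integral of `1 - F` from `0` to `x`. -/
def surplus (F : ProbabilityMeasure I) (x : ℝ) : ℝ := ∫ t in (0 : ℝ)..x, (1 - cdf F t)

theorem intervalIntegrable_one_sub_cdf (F : ProbabilityMeasure I) (a b : ℝ) :
    IntervalIntegrable (fun t => 1 - cdf F t) volume a b :=
  intervalIntegrable_const.sub (monotone_cdf' F).intervalIntegrable

/-- Layer-cake formula: the tail of (v - h)⁺ at t > 0 is 1 - F(h + t), which vanishes for t ≥ 1 - h.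
-/
theorem integral_max_sub (F : ProbabilityMeasure I) (h : I) :
    ∫ v : I, max ((v : ℝ) - h) 0 ∂(F : Measure I) = surplus F 1 - surplus F h := by
  have hm : Measurable fun v : I => max ((v : ℝ) - h) 0 := by fun_prop
  have hint : Integrable (fun v : I => max ((v : ℝ) - h) 0) (F : Measure I) := by
    refine Integrable.of_bound hm.aestronglyMeasurable 1 (Eventually.of_forall fun v => ?_)
    rw [Real.norm_eq_abs, abs_of_nonneg (le_max_right _ _)]
    exact max_le (by linarith [v.2.2, h.2.1]) zero_le_one
  rw [hint.integral_eq_integral_meas_lt (Eventually.of_forall fun v => le_max_right _ _)]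
  have h1 : ∀ t ∈ Ioi (0 : ℝ), (F : Measure I).real {v : I | t < max ((v : ℝ) - h) 0} =
      1 - cdf F (h + t) := by
    intro t ht
    have : {v : I | t < max ((v : ℝ) - h) 0} = {v : I | (v : ℝ) ≤ h + t}ᶜ := by
      ext v
      simp only [mem_ofPred_eq, lt_max_iff, mem_compl_iff, not_le]
      constructor
      · rintro (h | h)
        · linarith
        · exact absurd h (not_lt.2 (le_of_lt ht))
      · intro h; left; linarith
    rw [this, probReal_compl_eq_one_sub (measurableSet_le measurable_subtype_coe measurable_const),
      ← cdf_eq_measureReal]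
  rw [setIntegral_congr_fun measurableSet_Ioi h1]
  have h2 : ∫ t in Ioi (0 : ℝ), (1 - cdf F (h + t)) = ∫ t in (0 : ℝ)..(1 - h), (1 - cdf F (h + t)) := by
    rw [intervalIntegral.integral_of_le (by linarith [h.2.2])]
    refine (setIntegral_eq_of_subset_of_forall_sdiff_eq_zero measurableSet_Ioi
      Ioc_subset_Ioi_self ?_)
    intro t ht
    have : 1 ≤ h + t := by
      by_contra hlt
      exact ht.2 ⟨ht.1, by linarith⟩
    rw [cdf_eq_one F this, sub_self]
  rw [h2, intervalIntegral.integral_comp_add_left (fun t => 1 - cdf F t) (h : ℝ)]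
  have := intervalIntegral.integral_add_adjacent_intervals
    (intervalIntegrable_one_sub_cdf F 0 h) (intervalIntegrable_one_sub_cdf F h 1)
  simp only [surplus, add_zero, add_sub_cancel]
  linarith

theorem integral_quantile (F : ProbabilityMeasure I) :
    ∫ t in (0 : ℝ)..1, quantile F t = surplus F 1 := by
  have h := integral_max_sub F 0
  rw [integral_quantileI F (by fun_prop)] at h
  rw [← integral_unitInterval_eq]
  simpa [surplus, quantileI, quantile_nonneg] using h

/-! ### Expected utility and regret against deterministic competing bids -/

theorem measurable_utility : Measurable fun p : I × I × I => utility p.1 p.2.1 p.2.2 := by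
  unfold utility
  refine Measurable.ite (measurableSet_le (by fun_prop) (by fun_prop)) (by fun_prop) (by fun_prop)

theorem utility_le (b h v : I) : utility b h v ≤ max ((v : ℝ) - h) 0 := by
  unfold utility
  split_ifs with hb
  · exact le_max_of_le_left (sub_le_sub_left (show (h : ℝ) ≤ b from hb) _)
  · exact le_max_right _ _

theorem integrable_utility_bid (μ : Measure I) [IsFiniteMeasure μ] (h v : I) :
    Integrable (fun b => utility b h v) μ :=
  Integrable.of_bound
    (measurable_utility.comp (f := fun b : I => (b, h, v)) (by fun_prop)).aestronglyMeasurable 1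
    (Eventually.of_forall fun b => abs_utility_le_one b h v)

/-- The expected utility, at value `v`, of the strategy `s` against the competing bid `h`. -/
def interimUtility (s : Strategy) (v h : I) : ℝ := ∫ b, utility b h v ∂(s.1 v)

theorem measurable_interimUtility (s : Strategy) :
    Measurable fun p : I × I => interimUtility s p.1 p.2 := by
  have h := StronglyMeasurable.integral_kernel_prod_right' (κ := s.1.comap Prod.fst measurable_fst)
    (f := fun p : (I × I) × I => utility p.2 p.1.2 p.1.1)
    (measurable_utility.comp
      (f := fun p : (I × I) × I => (p.2, p.1.2, p.1.1)) (by fun_prop)).stronglyMeasurable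
  exact h.measurable

theorem abs_interimUtility_le_one (s : Strategy) (v h : I) : |interimUtility s v h| ≤ 1 := by
  have h' := norm_integral_le_of_norm_le_const (μ := s.1 v) (C := 1)
    (f := fun b => utility b h v)
    (Eventually.of_forall fun b => abs_utility_le_one b h v)
  simpa [interimUtility] using h'

theorem interimUtility_le (s : Strategy) (v h : I) :
    interimUtility s v h ≤ max ((v : ℝ) - h) 0 := by
  have := integral_mono (integrable_utility_bid (s.1 v) h v) (integrable_const (max ((v : ℝ) - h) 0))
    (fun b => utility_le b h v)
  simpa [interimUtility] using this

theorem integrable_interimUtility (s : Strategy) (μ : Measure (I × I)) [IsFiniteMeasure μ] :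
    Integrable (fun p : I × I => interimUtility s p.1 p.2) μ :=
  Integrable.of_bound (measurable_interimUtility s).aestronglyMeasurable 1
    (Eventually.of_forall fun p => abs_interimUtility_le_one s p.1 p.2)

/-- The expected utility of the strategy `s` against the competing bid `h`. -/
def payoff (F : ProbabilityMeasure I) (s : Strategy) (h : I) : ℝ :=
  ∫ v, interimUtility s v h ∂(F : Measure I)

theorem integrable_payoff (F : ProbabilityMeasure I) (s : Strategy) (H : ProbabilityMeasure I) :
    Integrable (payoff F s) (H : Measure I) :=
  (integrable_interimUtility s ((F : Measure I).prod (H : Measure I))).integral_prod_right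

theorem expectedUtility_eq_integral_payoff (F : ProbabilityMeasure I) (s : Strategy)
    (H : ProbabilityMeasure I) : expectedUtility F s H = ∫ h, payoff F s h ∂(H : Measure I) :=
  integral_prod_symm _ (integrable_interimUtility s ((F : Measure I).prod (H : Measure I)))

theorem expectedUtility_diracProba (F : ProbabilityMeasure I) (s : Strategy) (h : I) :
    expectedUtility F s (diracProba h) = payoff F s h := by
  rw [expectedUtility_eq_integral_payoff]
  exact integral_dirac _ _

theorem integral_utility_bid (H : ProbabilityMeasure I) (b v : I) :
    ∫ h, utility b h v ∂(H : Measure I) = ((v : ℝ) - b) * cdf H b := by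
  have : (fun h => utility b h v) = (Iic b).indicator fun _ => (v : ℝ) - b := by
    ext h
    simp [utility, indicator]
  rw [this, integral_indicator_const _ measurableSet_Iic, cdf_eq_measureReal, smul_eq_mul, mul_comm]
  rfl

theorem expectedUtility_eq_integral_cdf (F : ProbabilityMeasure I) (s : Strategy)
    (H : ProbabilityMeasure I) : expectedUtility F s H =
      ∫ v, ∫ b : I, ((v : ℝ) - b) * cdf H b ∂(s.1 v) ∂(F : Measure I) := by
  have h1 := integral_prod _
    (integrable_interimUtility s ((F : Measure I).prod (H : Measure I)))
  refine h1.trans (integral_congr_ae (Eventually.of_forall fun v => ?_))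
  have h2 := integral_integral_swap (μ := (H : Measure I)) (ν := s.1 v)
    (f := fun h b => utility b h v)
    (Integrable.of_bound
      (measurable_utility.comp (f := fun p : I × I => (p.2, p.1, v))
        (by fun_prop)).aestronglyMeasurable 1
      (Eventually.of_forall fun p => abs_utility_le_one p.2 p.1 v))
  simp only [integral_utility_bid] at h2
  exact h2

theorem continuous_surplus (F : ProbabilityMeasure I) : Continuous (surplus F) :=
  intervalIntegral.continuous_primitive (fun a b => intervalIntegrable_one_sub_cdf F a b) 0

theorem integrable_surplus (F H : ProbabilityMeasure I) :
    Integrable (fun h : I => surplus F 1 - surplus F h) (H : Measure I) := by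
  have hc : Continuous fun h : I => surplus F 1 - surplus F h :=
    continuous_const.sub ((continuous_surplus F).comp continuous_subtype_val)
  exact hc.integrable_of_hasCompactSupport (HasCompactSupport.of_compactSpace _)

theorem payoff_le (F : ProbabilityMeasure I) (s : Strategy) (h : I) :
    payoff F s h ≤ surplus F 1 - surplus F h := by
  rw [← integral_max_sub]
  have hm : Measurable fun v : I => interimUtility s v h :=
    (measurable_interimUtility s).comp (measurable_id.prodMk measurable_const)
  refine integral_mono (Integrable.of_bound hm.aestronglyMeasurable 1
      (Eventually.of_forall fun v => abs_interimUtility_le_one s v h))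
    (Integrable.of_bound (Measurable.aestronglyMeasurable (by fun_prop)) 1
      (Eventually.of_forall fun v => ?_)) (fun v => interimUtility_le s v h)
  rw [Real.norm_eq_abs, abs_of_nonneg (le_max_right _ _)]
  exact max_le (by linarith [v.2.2, h.2.1]) zero_le_one

/-- The strategy that bids `h` at values of at least `h` and `0` at all other values. -/
def matchingStrategy (h : I) : Strategy :=
  ⟨Kernel.deterministic (fun v => if h ≤ v then h else 0)
    (Measurable.ite measurableSet_Ici measurable_const measurable_const), inferInstance⟩

theorem payoff_matchingStrategy (F : ProbabilityMeasure I) (h : I) :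
    payoff F (matchingStrategy h) h = surplus F 1 - surplus F h := by
  rw [← integral_max_sub]
  refine integral_congr_ae (Eventually.of_forall fun v => ?_)
  have : interimUtility (matchingStrategy h) v h = utility (if h ≤ v then h else 0) h v := by
    simp only [interimUtility, matchingStrategy, Kernel.deterministic_apply, integral_dirac]
  simp only [this, utility]
  by_cases hv : h ≤ v
  · rw [if_pos hv, if_pos le_rfl, max_eq_left (sub_nonneg.2 (show (h : ℝ) ≤ v from hv))]
  · have hv' : (v : ℝ) < h := not_le.1 hv
    rw [if_neg hv, if_neg, max_eq_right (by linarith)]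
    intro h0
    exact hv (h0.trans v.2.1)

/-- The pointwise bound (v - h)⁺ is attained by the strategy that matches h whenever this is
profitable, so the supremum is explicit. -/
theorem regret_diracProba (F : ProbabilityMeasure I) (s : Strategy) (h : I) :
    regret F s (diracProba h) = surplus F 1 - surplus F h - payoff F s h := by
  have : Nonempty Strategy := ⟨s⟩
  have h1 : (⨆ s' : Strategy, expectedUtility F s' (diracProba h)) = surplus F 1 - surplus F h := by
    refine le_antisymm (ciSup_le fun s' => ?_) ?_
    · rw [expectedUtility_diracProba]
      exact payoff_le F s' h
    · rw [← payoff_matchingStrategy, ← expectedUtility_diracProba]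
      exact le_ciSup (bddAbove_expectedUtility F (diracProba h)) (matchingStrategy h)
  rw [regret, h1, expectedUtility_diracProba]

theorem integrable_regret_diracProba (F : ProbabilityMeasure I) (s : Strategy)
    (H : ProbabilityMeasure I) :
    Integrable (fun h => regret F s (diracProba h)) (H : Measure I) := by
  simp only [regret_diracProba]
  exact (integrable_surplus F H).sub (integrable_payoff F s H)

/-- The benchmark on the right may depend on the realized h, the one on the left only on H; this
reduces worst-case regret to deterministic competing bids. -/
theorem regret_le_integral_diracProba (F : ProbabilityMeasure I) (s : Strategy)
    (H : ProbabilityMeasure I) :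
    regret F s H ≤ ∫ h, regret F s (diracProba h) ∂(H : Measure I) := by
  have : Nonempty Strategy := ⟨s⟩
  simp only [regret_diracProba]
  rw [integral_sub (integrable_surplus F H) (integrable_payoff F s H),
    ← expectedUtility_eq_integral_payoff]
  refine sub_le_sub_right (ciSup_le fun s' => ?_) _
  rw [expectedUtility_eq_integral_payoff]
  exact integral_mono (integrable_payoff F s' H) (integrable_surplus F H) (payoff_le F s')

/-- By right-continuity a law is determined by its CDF at rational points, and comparing these with
rationals gives countably many separating sets. Then the measurable injection h ↦ δ_h is a
measurable embedding, and integrals over Dirac mixtures can be pulled back without proving `regret`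
measurable in H. -/
instance countablySeparated_probabilityMeasure :
    MeasurableSpace.CountablySeparated (ProbabilityMeasure I) := by
  refine ⟨⟨Set.range fun p : ℚ × ℚ => {μ : ProbabilityMeasure I | (p.2 : ℝ) < cdf μ p.1},
    countable_range _, ?_, ?_⟩⟩
  · rintro _ ⟨p, rfl⟩
    have hm : Measurable fun μ : ProbabilityMeasure I => cdf μ p.1 := by
      simp only [cdf_eq_measureReal, measureReal_def]
      exact ((Measure.measurable_coe (measurableSet_le measurable_subtype_coe
        measurable_const)).comp measurable_subtype_coe).ennreal_toReal
    exact measurableSet_lt measurable_const hm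
  · intro μ _ ν _ h
    have h1 : ∀ r : ℚ, cdf μ r = cdf ν r := by
      intro r
      refine eq_of_forall_rat_lt_iff_lt fun q => ?_
      exact h _ ⟨(r, q), rfl⟩
    have hlim (ρ : ProbabilityMeasure I) (x : ℝ) : Tendsto (cdf ρ) (𝓝[>] x) (𝓝 (cdf ρ x)) :=
      (continuousWithinAt_cdf ρ x).tendsto.mono_left (nhdsWithin_mono _ Ioi_subset_Ici_self)
    have hle (ρ π : ProbabilityMeasure I) (h : ∀ r : ℚ, cdf ρ r = cdf π r) (x : ℝ) :
        cdf ρ x ≤ cdf π x := by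
      refine ge_of_tendsto (hlim π x) ?_
      filter_upwards [self_mem_nhdsWithin] with y hy
      obtain ⟨r, hr1, hr2⟩ := exists_rat_btwn (show x < y from hy)
      exact (monotone_cdf' ρ hr1.le).trans ((h r).trans_le (monotone_cdf' π hr2.le))
    suffices (μ : Measure I) = ν from Subtype.ext this
    refine Measure.ext_of_Iic _ _ fun x => ?_
    have h2 := le_antisymm (hle μ ν h1 x) (hle ν μ (fun r => (h1 r).symm) x)
    rw [cdf_eq_measureReal, cdf_eq_measureReal] at h2
    exact (measureReal_eq_measureReal_iff).1 h2

theorem measurableEmbedding_diracProba : MeasurableEmbedding fun h : I => diracProba h :=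
  measurable_diracProba'.measurableEmbedding injective_diracProba

theorem mixedRegret_diracMixture (F : ProbabilityMeasure I) (s : Strategy)
    (H : ProbabilityMeasure I) :
    mixedRegret F s (diracMixture H) = ∫ h, regret F s (diracProba h) ∂(H : Measure I) :=
  measurableEmbedding_diracProba.integral_map _

theorem mixedRegret_diracMixture_eq (F : ProbabilityMeasure I) (s : Strategy)
    (H : ProbabilityMeasure I) : mixedRegret F s (diracMixture H) =
      ∫ h : I, (surplus F 1 - surplus F h) ∂(H : Measure I) - expectedUtility F s H := by
  rw [mixedRegret_diracMixture, expectedUtility_eq_integral_payoff,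
    ← integral_sub (integrable_surplus F H) (integrable_payoff F s H)]
  simp only [regret_diracProba]

theorem mixedRegret_diracMixture_le_worstRegret (F : ProbabilityMeasure I) (s : Strategy)
    (H : ProbabilityMeasure I) : mixedRegret F s (diracMixture H) ≤ worstRegret F s := by
  rw [mixedRegret_diracMixture]
  have := integral_mono (integrable_regret_diracProba F s H)
    (integrable_const (μ := (H : Measure I)) (worstRegret F s))
    (fun h => le_ciSup (bddAbove_regret F s) (diracProba h))
  simpa using this

/-! ### The joint distribution of values and bids under a quantile-based strategy -/

theorem quantileSet_eq_preimage (F : ProbabilityMeasure I) (v : I) :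
    quantileSet F v = quantileI F ⁻¹' {v} := by
  ext y
  simp [quantileSet, quantileI, Subtype.ext_iff]

/-- If F(F⁻(y)) exceeded y, the whole interval between them would consist of quantiles of the same
value, giving it positive measure. -/
theorem cdfI_quantileI (F : ProbabilityMeasure I) {y : I}
    (h : (volume : Measure I) (quantileSet F (quantileI F y)) = 0) :
    cdfI F (quantileI F y) = y := by
  refine le_antisymm (not_lt.1 fun hlt => ?_) (le_cdf_quantile F y.2.2)
  have hsub : Icc y (cdfI F (quantileI F y)) ⊆ quantileSet F (quantileI F y) := by
    intro z hz
    exact le_antisymm ((quantile_le_iff F z.2.2 (quantileI F y).2).2 hz.2)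
      (monotone_quantileI F hz.1)
  have := measure_mono_null hsub h
  rw [unitInterval.volume_Icc, ENNReal.ofReal_eq_zero] at this
  exact absurd (show y < cdfI F (quantileI F y) from hlt)
    (not_lt.2 (show (cdfI F (quantileI F y) : ℝ) ≤ y by linarith))

theorem integral_quantileBid_mul (F : ProbabilityMeasure I) (Q : QuantileStrategy) {v : I}
    (hv : (volume : Measure I) (quantileSet F v) ≠ 0) {f : I → ℝ} (hf : Measurable f) :
    (volume : Measure I).real (quantileSet F v) * ∫ b, f b ∂(quantileBid F Q v) =
      ∫ y in quantileSet F v, f (Q y) := by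
  rw [quantileBid, if_neg hv, integral_map Q.measurable.aemeasurable hf.aestronglyMeasurable,
    ProbabilityTheory.cond, integral_smul_measure, ENNReal.toReal_inv, smul_eq_mul, measureReal_def,
    mul_inv_cancel_left₀]
  exact ENNReal.toReal_ne_zero.2 ⟨hv, measure_ne_top _ _⟩

/-- The quantiles split into the countably many sets Y(v) of positive measure and the rest. On such
a Y(v), the uniform bid times λ(Y(v)) is the integral over Y(v); elsewhere F(F⁻(y)) = y, so the bid
is Q(y). -/
theorem integral_toStrategy (F : ProbabilityMeasure I) (Q : QuantileStrategy) {f : I → I → ℝ}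
    (hf : Measurable fun p : I × I => f p.1 p.2) (hf1 : ∀ v b, |f v b| ≤ 1) :
    ∫ v, ∫ b, f v b ∂((Q.toStrategy F).1 v) ∂(F : Measure I) =
      ∫ y, f (quantileI F y) (Q y) := by
  set g : I → ℝ := fun v => ∫ b, f v b ∂((Q.toStrategy F).1 v) with hg
  have hgm : Measurable g :=
    (StronglyMeasurable.integral_kernel_prod_right' (κ := (Q.toStrategy F).1)
      hf.stronglyMeasurable).measurable
  have hg1 : ∀ v, |g v| ≤ 1 := fun v => by
    have h' := norm_integral_le_of_norm_le_const (μ := (Q.toStrategy F).1 v) (C := 1)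
      (f := fun b => f v b) (Eventually.of_forall fun b => hf1 v b)
    simpa [hg] using h'
  rw [integral_quantileI F hgm]
  have hi1 : Integrable (fun y => g (quantileI F y)) (volume : Measure I) :=
    Integrable.of_bound (hgm.comp (measurable_quantileI F)).aestronglyMeasurable 1
      (Eventually.of_forall fun y => hg1 _)
  have hi2 : Integrable (fun y => f (quantileI F y) (Q y)) (volume : Measure I) :=
    Integrable.of_bound (hf.comp ((measurable_quantileI F).prodMk Q.measurable)).aestronglyMeasurable
      1 (Eventually.of_forall fun y => hf1 _ _)
  set A : Set I := {v : I | 0 < (volume : Measure I) (quantileSet F v)}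
  have hA : A.Countable :=
    Measure.countable_meas_pos_of_disjoint_iUnion (measurableSet_quantileSet F) (by
      intro v w hvw
      simp only [Function.onFun, quantileSet_eq_preimage]
      exact Disjoint.preimage _ (disjoint_singleton.2 hvw))
  have hN : quantileI F ⁻¹' A = ⋃ v : A, quantileSet F v := by
    ext y
    simp [quantileSet_eq_preimage]
  have hNm : MeasurableSet (quantileI F ⁻¹' A) := measurable_quantileI F hA.measurableSet
  rw [← integral_add_compl hNm hi1, ← integral_add_compl hNm hi2]
  congr 1
  · have : Countable A := hA
    have hdisj : Pairwise (Function.onFun Disjoint fun v : A => quantileSet F v) := by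
      intro v w hvw
      simp only [Function.onFun, quantileSet_eq_preimage]
      exact Disjoint.preimage _ (disjoint_singleton.2 (Subtype.coe_injective.ne hvw))
    rw [hN, integral_iUnion (fun v : A => measurableSet_quantileSet F v) hdisj hi1.integrableOn,
      integral_iUnion (fun v : A => measurableSet_quantileSet F v) hdisj hi2.integrableOn]
    refine tsum_congr fun v => ?_
    have hq : ∀ y ∈ quantileSet F v, quantileI F y = v := fun y hy => Subtype.ext hy
    have h1 : ∫ y in quantileSet F v, g (quantileI F y) = ∫ y in quantileSet F v, g v :=
      setIntegral_congr_fun (measurableSet_quantileSet F v) fun y hy => by simp only [hq y hy]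
    have h2 : ∫ y in quantileSet F v, f (quantileI F y) (Q y) =
        ∫ y in quantileSet F v, f v (Q y) :=
      setIntegral_congr_fun (measurableSet_quantileSet F v) fun y hy => by simp only [hq y hy]
    rw [h1, h2, setIntegral_const, smul_eq_mul]
    exact integral_quantileBid_mul F Q v.2.ne' (hf.comp (measurable_const.prodMk measurable_id))
  · refine setIntegral_congr_fun hNm.compl fun y hy => ?_
    have h0 : (volume : Measure I) (quantileSet F (quantileI F y)) = 0 := by
      simpa [A] using hy
    change ∫ b, f (quantileI F y) b ∂(quantileBid F Q (quantileI F y)) = _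
    rw [quantileBid, if_pos h0, integral_dirac, cdfI_quantileI F h0]

theorem payoff_toStrategy (F : ProbabilityMeasure I) (Q : QuantileStrategy) (h : I) :
    payoff F (Q.toStrategy F) h = ∫ y, utility (Q y) h (quantileI F y) :=
  integral_toStrategy F Q (f := fun v b => utility b h v)
    (measurable_utility.comp (f := fun p : I × I => (p.2, h, p.1)) (by fun_prop))
    fun v b => abs_utility_le_one b h v

theorem expectedUtility_toStrategy (F : ProbabilityMeasure I) (Q : QuantileStrategy)
    (H : ProbabilityMeasure I) : expectedUtility F (Q.toStrategy F) H =
      ∫ y : I, (quantile F y - Q y) * cdf H (Q y) := by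
  rw [expectedUtility_eq_integral_cdf]
  refine integral_toStrategy F Q (f := fun v b : I => ((v : ℝ) - b) * cdf H b) ?_ fun v b => ?_
  · exact Measurable.mul (by fun_prop) ((measurable_cdf H).comp (by fun_prop))
  · rw [abs_mul, abs_of_nonneg (cdf_nonneg' H _)]
    have : |(v : ℝ) - b| ≤ 1 := by
      rw [abs_le]; constructor <;> linarith [v.2.1, v.2.2, b.2.1, b.2.2]
    exact mul_le_one₀ this (cdf_nonneg' H _) (cdf_le_one' H _)

/-! ### Absolutely continuous functions -/

theorem _root_.LipschitzOnWith.comp_absolutelyContinuousOnInterval {f g : ℝ → ℝ} {K : NNReal}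
    {s : Set ℝ} {a b : ℝ} (hg : LipschitzOnWith K g s) (hf : AbsolutelyContinuousOnInterval f a b)
    (hs : MapsTo f (uIcc a b) s) : AbsolutelyContinuousOnInterval (fun x => g (f x)) a b := by
  rw [absolutelyContinuousOnInterval_iff] at hf ⊢
  intro ε hε
  -- Dividing by K + 1 rather than K covers K = 0.
  obtain ⟨δ, hδ, h⟩ := hf (ε / (K + 1)) (by positivity)
  refine ⟨δ, hδ, fun E hE hlt => ?_⟩
  have h1 : ∑ i ∈ Finset.range E.1, dist (g (f (E.2 i).1)) (g (f (E.2 i).2)) ≤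
      ∑ i ∈ Finset.range E.1, K * dist (f (E.2 i).1) (f (E.2 i).2) :=
    Finset.sum_le_sum fun i hi => hg.dist_le_mul _ (hs (hE.1 i hi).1) _ (hs (hE.1 i hi).2)
  rw [← Finset.mul_sum] at h1
  have h2 := h E hE hlt
  have h3 : 0 ≤ ∑ i ∈ Finset.range E.1, dist (f (E.2 i).1) (f (E.2 i).2) :=
    Finset.sum_nonneg fun _ _ => dist_nonneg
  rw [lt_div_iff₀ (by positivity)] at h2
  nlinarith [K.2]

theorem _root_.AbsolutelyContinuousOnInterval.integral_eq_sub_of_ae_hasDerivAt {f f' : ℝ → ℝ}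
    {a b x y : ℝ} (hf : AbsolutelyContinuousOnInterval f a b)
    (hf' : ∀ᵐ t ∂(volume.restrict (uIcc a b)), HasDerivAt f (f' t) t)
    (hx : x ∈ uIcc a b) (hy : y ∈ uIcc a b) : ∫ t in x..y, f' t = f y - f x := by
  have hsub : uIcc x y ⊆ uIcc a b := uIcc_subset_uIcc hx hy
  rw [← (hf.mono hsub).integral_deriv_eq_sub]
  refine intervalIntegral.integral_congr_ae ?_
  rw [ae_restrict_iff' measurableSet_uIcc] at hf'
  filter_upwards [hf'] with t ht hmem
  exact (ht (hsub (uIoc_subset_uIcc hmem))).deriv.symm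

/-! ### Properties of the optimal quantile-based strategy -/

theorem extend_coe (Q : I → I) (y : I) : extend Q y = Q y := by
  simp [extend, projIcc_val]

theorem QuantileStrategy.monotone_extend (Q : QuantileStrategy) : Monotone (extend Q) :=
  fun _ _ h => Q.strictMono.monotone (monotone_projIcc _ h)

theorem QuantileStrategy.strictMonoOn_extend (Q : QuantileStrategy) :
    StrictMonoOn (extend Q) (Icc 0 1) :=
  fun _ hx _ hy h => Q.strictMono ((strictMonoOn_projIcc zero_le_one) hx hy h)

theorem QuantileStrategy.extend_le (Q : QuantileStrategy) (t : ℝ) : extend Q t ≤ Q 1 :=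
  Q.strictMono.monotone le_one'

theorem QuantileStrategy.continuousOn_extend (Q : QuantileStrategy) :
    ContinuousOn (extend Q) (Icc 0 1) := by
  simpa using Q.absCont.continuousOn

theorem QuantileStrategy.exists_eq {Q : QuantileStrategy} (hQ : Q 0 = 0) {x : I} (hx : x ≤ Q 1) :
    ∃ y, Q y = x := by
  have h0 : extend Q 0 = 0 := by simpa [hQ] using extend_coe Q 0
  have h1 : extend Q 1 = Q 1 := by simpa using extend_coe Q 1
  obtain ⟨t, ht, hxt⟩ := intermediate_value_Icc zero_le_one Q.continuousOn_extend
    (show (x : ℝ) ∈ Icc (extend Q 0) (extend Q 1) from ⟨by rw [h0]; exact x.2.1, by rw [h1]; exact hx⟩)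
  exact ⟨⟨t, ht⟩, Subtype.ext (by rw [← hxt, ← extend_coe])⟩

/-- A monotone function has countably many discontinuities, and an injective Q hits each at most
once. This licenses the chain rule a.e. even when F has atoms. -/
theorem QuantileStrategy.ae_continuousAt (Q : QuantileStrategy) {f : ℝ → ℝ} (hf : Monotone f) :
    ∀ᵐ t ∂(volume.restrict (Icc (0 : ℝ) 1)), ContinuousAt f (extend Q t) := by
  have hc : {t : ℝ | t ∈ Icc (0 : ℝ) 1 ∧ ¬ ContinuousAt f (extend Q t)}.Countable :=
    MapsTo.countable_of_injOn (f := extend Q) (t := {x | ¬ ContinuousAt f x}) (fun t ht => ht.2)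
      (Q.strictMonoOn_extend.injOn.mono fun t ht => ht.1) hf.countable_not_continuousAt
  rw [ae_restrict_iff' measurableSet_Icc]
  filter_upwards [hc.ae_notMem volume] with t ht hmem
  by_contra h
  exact ht ⟨hmem, h⟩

variable {F : ProbabilityMeasure I} {Q : QuantileStrategy}

/-- This is Q(1) < F⁻(1) read through the Galois connection; it keeps the denominators of the
equation away from zero. -/
theorem IsOptimalQuantile.cdf_lt_one (hQ : IsOptimalQuantile F Q) : cdf F (Q 1) < 1 := by
  have := hQ.lt 1 zero_lt_one
  rwa [Icc.coe_one, lt_quantile_iff F le_rfl (Q 1).2] at this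

theorem IsOptimalQuantile.one_sub_cdf_pos (hQ : IsOptimalQuantile F Q) (t : ℝ) :
    0 < 1 - cdf F (extend Q t) := by
  linarith [hQ.cdf_lt_one, monotone_cdf' F (Q.extend_le t)]

theorem surplus_sub_surplus (F : ProbabilityMeasure I) (a b : ℝ) :
    surplus F b - surplus F a = ∫ t in a..b, (1 - cdf F t) :=
  intervalIntegral.integral_interval_sub_left (intervalIntegrable_one_sub_cdf F 0 b)
    (intervalIntegrable_one_sub_cdf F 0 a)

theorem monotone_surplus (F : ProbabilityMeasure I) : Monotone (surplus F) := by
  intro a b hab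
  rw [← sub_nonneg, surplus_sub_surplus]
  exact intervalIntegral.integral_nonneg hab fun t _ => sub_nonneg.2 (cdf_le_one' F t)

theorem lipschitzWith_surplus (F : ProbabilityMeasure I) : LipschitzWith 1 (surplus F) := by
  refine LipschitzWith.of_dist_le_mul fun a b => ?_
  rw [dist_eq_norm, surplus_sub_surplus, Real.dist_eq]
  refine intervalIntegral.norm_integral_le_of_norm_le_const fun t _ => ?_
  rw [Real.norm_eq_abs, abs_of_nonneg (sub_nonneg.2 (cdf_le_one' F t))]
  simpa using cdf_nonneg' F t

theorem hasDerivAt_surplus (F : ProbabilityMeasure I) {x : ℝ} (hx : ContinuousAt (cdf F) x) :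
    HasDerivAt (surplus F) (1 - cdf F x) x :=
  intervalIntegral.integral_hasDerivAt_right (intervalIntegrable_one_sub_cdf F 0 x)
    ((measurable_const.sub (measurable_cdf F)).stronglyMeasurable.stronglyMeasurableAtFilter)
    (continuousAt_const.sub hx)

/-- In the chain rule for S ∘ Q the factor 1 - F(Q) cancels the denominator of the differential
equation. -/
theorem IsOptimalQuantile.integral_sub (hQ : IsOptimalQuantile F Q) {x y : ℝ}
    (hx : x ∈ Icc (0 : ℝ) 1) (hy : y ∈ Icc (0 : ℝ) 1) :
    ∫ t in x..y, (quantile F t - extend Q t) =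
      surplus F (extend Q y) - surplus F (extend Q x) := by
  have hac : AbsolutelyContinuousOnInterval (fun t => surplus F (extend Q t)) 0 1 :=
    ((lipschitzWith_surplus F).lipschitzOnWith (s := univ)).comp_absolutelyContinuousOnInterval
      Q.absCont (mapsTo_univ _ _)
  rw [← uIcc_of_le zero_le_one] at hx hy
  refine hac.integral_eq_sub_of_ae_hasDerivAt ?_ hx hy
  rw [uIcc_of_le zero_le_one]
  filter_upwards [hQ.ode, Q.ae_continuousAt (monotone_cdf' F)] with t ht hc
  have := (hasDerivAt_surplus F hc).comp t ht
  rwa [mul_div_cancel₀ _ (hQ.one_sub_cdf_pos t).ne'] at this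

theorem intervalIntegrable_quantile (F : ProbabilityMeasure I) {x y : ℝ} (hx : x ∈ Icc (0 : ℝ) 1)
    (hy : y ∈ Icc (0 : ℝ) 1) : IntervalIntegrable (quantile F) volume x y := by
  refine MonotoneOn.intervalIntegrable fun a _ b hb hab => quantile_mono F hab ?_
  exact ((uIcc_subset_Icc hx hy) hb).2

theorem IsOptimalQuantile.surplus_sub (hQ : IsOptimalQuantile F Q) :
    surplus F 1 - surplus F (Q 1) = ∫ t in (0 : ℝ)..1, extend Q t := by
  have h := hQ.integral_sub (x := 0) (y := 1) (by simp) (by simp)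
  have h0 : extend Q 0 = 0 := by simpa [hQ.zero] using extend_coe Q 0
  have h1 : extend Q 1 = Q 1 := by simpa using extend_coe Q 1
  rw [intervalIntegral.integral_sub (intervalIntegrable_quantile F (by simp) (by simp))
    Q.monotone_extend.intervalIntegrable, integral_quantile, h0, h1] at h
  have h2 : surplus F 0 = 0 := intervalIntegral.integral_same
  linarith

/-- As Q is strictly increasing, the bid Q(z) wins against Q(y) exactly when z ≥ y. -/
theorem IsOptimalQuantile.payoff_eq (hQ : IsOptimalQuantile F Q) (y : I) :
    payoff F (Q.toStrategy F) (Q y) = surplus F (Q 1) - surplus F (Q y) := by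
  rw [payoff_toStrategy]
  have h1 : (fun z : I => utility (Q z) (Q y) (quantileI F z)) = fun z : I =>
      (Ici (y : ℝ)).indicator (fun t => quantile F t - extend Q t) z := by
    ext z
    simp only [utility, indicator, Q.strictMono.le_iff_le, mem_Ici, Subtype.coe_le_coe, extend_coe]
    rfl
  rw [h1, integral_unitInterval_eq, intervalIntegral.integral_of_le zero_le_one,
    ← integral_Icc_eq_integral_Ioc, setIntegral_indicator measurableSet_Ici]
  have h2 : Icc (0 : ℝ) 1 ∩ Ici (y : ℝ) = Icc (y : ℝ) 1 := by
    ext t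
    simp only [mem_inter_iff, mem_Icc, mem_Ici]
    exact ⟨fun h => ⟨h.2, h.1.2⟩, fun h => ⟨⟨y.2.1.trans h.1, h.2⟩, h.1⟩⟩
  rw [h2, integral_Icc_eq_integral_Ioc, ← intervalIntegral.integral_of_le y.2.2,
    hQ.integral_sub y.2 (by simp), extend_coe]
  congr 2
  simpa using extend_coe Q 1

theorem IsOptimalQuantile.regret_diracProba_eq (hQ : IsOptimalQuantile F Q) {h : I}
    (hh : h ≤ Q 1) :
    regret F (Q.toStrategy F) (diracProba h) = ∫ t in (0 : ℝ)..1, extend Q t := by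
  obtain ⟨y, rfl⟩ := QuantileStrategy.exists_eq hQ.zero hh
  rw [regret_diracProba, hQ.payoff_eq, ← hQ.surplus_sub]
  ring

/-- Above Q(1) the strategy never wins, while the benchmark S(1) - S(h) can only fall as h grows. -/
theorem IsOptimalQuantile.regret_diracProba_le (hQ : IsOptimalQuantile F Q) (h : I) :
    regret F (Q.toStrategy F) (diracProba h) ≤ ∫ t in (0 : ℝ)..1, extend Q t := by
  rcases le_or_gt h (Q 1) with hh | hh
  · exact (hQ.regret_diracProba_eq hh).le
  · have h0 : payoff F (Q.toStrategy F) h = 0 := by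
      rw [payoff_toStrategy]
      have : ∀ y, utility (Q y) h (quantileI F y) = 0 := fun y =>
        if_neg (not_le.2 ((Q.strictMono.monotone le_one').trans_lt hh))
      simp [this]
    rw [regret_diracProba, h0, ← hQ.surplus_sub]
    have := monotone_surplus F (show (Q 1 : ℝ) ≤ h from hh.le)
    linarith

theorem IsOptimalQuantile.regret_le (hQ : IsOptimalQuantile F Q) (H : ProbabilityMeasure I) :
    regret F (Q.toStrategy F) H ≤ ∫ t in (0 : ℝ)..1, extend Q t := by
  refine (regret_le_integral_diracProba F _ H).trans ?_
  have := integral_mono (integrable_regret_diracProba F (Q.toStrategy F) H)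
    (integrable_const (μ := (H : Measure I)) (∫ t in (0 : ℝ)..1, extend Q t))
    hQ.regret_diracProba_le
  simpa using this

/-! ### The competing bid distribution -/

/-- The integrand `1 / (1 - F (Q t))`. -/
def hazard (F : ProbabilityMeasure I) (Q : QuantileStrategy) (t : ℝ) : ℝ :=
  1 / (1 - cdf F (extend Q t))

theorem IsOptimalQuantile.one_le_hazard (hQ : IsOptimalQuantile F Q) (t : ℝ) :
    1 ≤ hazard F Q t := by
  rw [hazard, le_div_iff₀ (hQ.one_sub_cdf_pos t)]
  linarith [cdf_nonneg' F (extend Q t)]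

theorem IsOptimalQuantile.monotone_hazard (hQ : IsOptimalQuantile F Q) :
    Monotone (hazard F Q) := fun _ b hab =>
  one_div_le_one_div_of_le (hQ.one_sub_cdf_pos b)
    (sub_le_sub_left (monotone_cdf' F (Q.monotone_extend hab)) _)

/-- The probability `exp (- ∫ t in y..1, 1 / (1 - F (Q t)))` that the highest competing bid is at
most `Q y`. -/
def winProb (F : ProbabilityMeasure I) (Q : QuantileStrategy) (y : ℝ) : ℝ :=
  Real.exp (∫ t in (1 : ℝ)..y, hazard F Q t)

theorem winProb_pos (y : ℝ) : 0 < winProb F Q y := Real.exp_pos _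

theorem winProb_one : winProb F Q 1 = 1 := by simp [winProb]

theorem IsOptimalQuantile.strictMono_winProb (hQ : IsOptimalQuantile F Q) :
    StrictMono (winProb F Q) := by
  intro a b hab
  refine Real.exp_lt_exp.2 (sub_pos.1 ?_)
  rw [intervalIntegral.integral_interval_sub_left hQ.monotone_hazard.intervalIntegrable
    hQ.monotone_hazard.intervalIntegrable]
  have := intervalIntegral.integral_mono_on hab.le intervalIntegrable_const
    (hQ.monotone_hazard.intervalIntegrable (μ := volume)) fun t _ => hQ.one_le_hazard t
  rw [intervalIntegral.integral_const, smul_eq_mul, mul_one] at this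
  linarith

theorem IsOptimalQuantile.continuous_winProb (hQ : IsOptimalQuantile F Q) :
    Continuous (winProb F Q) :=
  Real.continuous_exp.comp (intervalIntegral.continuous_primitive
    (fun _ _ => hQ.monotone_hazard.intervalIntegrable) 1)

theorem IsOptimalQuantile.absolutelyContinuousOnInterval_winProb (hQ : IsOptimalQuantile F Q) :
    AbsolutelyContinuousOnInterval (winProb F Q) 0 1 := by
  -- The exponent of `winProb` is nonpositive on [0,1], where the exponential is 1-Lipschitz.
  have h1 : LipschitzOnWith 1 Real.exp (Iic 0) := by
    refine Convex.lipschitzOnWith_of_nnnorm_deriv_le (fun x _ => Real.differentiableAt_exp)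
      (fun x hx => ?_) (convex_Iic 0)
    rw [← NNReal.coe_le_coe, coe_nnnorm, Real.deriv_exp, Real.norm_eq_abs, Real.abs_exp]
    exact Real.exp_le_one_iff.2 hx
  have h2 : AbsolutelyContinuousOnInterval (fun y => ∫ t in (1 : ℝ)..y, hazard F Q t) 0 1 :=
    (hQ.monotone_hazard.intervalIntegrable).absolutelyContinuousOnInterval_intervalIntegral
      (by simp)
  refine h1.comp_absolutelyContinuousOnInterval h2 fun t ht => ?_
  rw [uIcc_of_le zero_le_one] at ht
  have h3 : winProb F Q t ≤ winProb F Q 1 := hQ.strictMono_winProb.monotone ht.2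
  rw [winProb_one] at h3
  exact Real.exp_le_one_iff.1 h3

theorem IsOptimalQuantile.hasDerivAt_winProb (hQ : IsOptimalQuantile F Q) {t : ℝ}
    (ht : ContinuousAt (hazard F Q) t) :
    HasDerivAt (winProb F Q) (winProb F Q t * hazard F Q t) t :=
  (intervalIntegral.integral_hasDerivAt_right hQ.monotone_hazard.intervalIntegrable
    hQ.monotone_hazard.measurable.stronglyMeasurable.stronglyMeasurableAtFilter ht).exp

/-- With hazard r, Q' = r (F⁻ - Q) and W' = r W, so in the derivative of (v - Q) W the terms
containing Q cancel. -/
theorem IsOptimalQuantile.integral_winProb (hQ : IsOptimalQuantile F Q) (v : ℝ) {x y : ℝ}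
    (hx : x ∈ Icc (0 : ℝ) 1) (hy : y ∈ Icc (0 : ℝ) 1) :
    ∫ t in x..y, winProb F Q t * hazard F Q t * (v - quantile F t) =
      (v - extend Q y) * winProb F Q y - (v - extend Q x) * winProb F Q x := by
  have hac : AbsolutelyContinuousOnInterval (fun t => (v - extend Q t) * winProb F Q t) 0 1 :=
    (((LipschitzWith.const v).lipschitzOnWith (K := 0)).absolutelyContinuousOnInterval.fun_sub
      Q.absCont).fun_mul hQ.absolutelyContinuousOnInterval_winProb
  rw [← uIcc_of_le zero_le_one] at hx hy
  refine hac.integral_eq_sub_of_ae_hasDerivAt ?_ hx hy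
  rw [uIcc_of_le zero_le_one]
  have hcont : ∀ᵐ t ∂(volume.restrict (Icc (0 : ℝ) 1)), ContinuousAt (hazard F Q) t :=
    ae_restrict_of_ae ((hQ.monotone_hazard.countable_not_continuousAt.ae_notMem volume).mono
      fun t ht => not_not.1 ht)
  filter_upwards [hQ.ode, hcont] with t ht hc
  refine ((ht.const_sub v).mul (hQ.hasDerivAt_winProb hc)).congr_deriv ?_
  have h0 := (hQ.one_sub_cdf_pos t).ne'
  rw [hazard]
  field_simp
  ring

/-- For v = F⁻(y) the integrand of `integral_winProb` is nonnegative before y and nonpositive after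
it, so (v - Q) W peaks at y. -/
theorem IsOptimalQuantile.sub_mul_winProb_le (hQ : IsOptimalQuantile F Q) (y z : I) :
    (quantile F y - Q z) * winProb F Q z ≤ (quantile F y - Q y) * winProb F Q y := by
  have h := hQ.integral_winProb (quantile F y) z.2 y.2
  rw [extend_coe, extend_coe] at h
  have hr (t : ℝ) : 0 ≤ winProb F Q t * hazard F Q t :=
    mul_nonneg (winProb_pos t).le (zero_le_one.trans (hQ.one_le_hazard t))
  rw [← sub_nonneg, ← h]
  rcases le_total z y with hzy | hzy
  · refine intervalIntegral.integral_nonneg hzy fun t ht => mul_nonneg (hr t) ?_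
    exact sub_nonneg.2 (quantile_mono F ht.2 y.2.2)
  · rw [intervalIntegral.integral_symm, ← intervalIntegral.integral_neg]
    refine intervalIntegral.integral_nonneg hzy fun t ht => neg_nonneg.2
      (mul_nonpos_of_nonneg_of_nonpos (hr t) ?_)
    exact sub_nonpos.2 (quantile_mono F ht.1 (ht.2.trans z.2.2))

/-- H is the law of Q(W⁻¹(max(U, W(0)))) for uniform U; since W(0) > 0, the truncation puts an atom
of mass W(0) at the bid Q(0) = 0. -/
theorem IsOptimalQuantile.exists_competingBid (hQ : IsOptimalQuantile F Q) :
    ∃ H : ProbabilityMeasure I, ∀ y : I, cdf H (Q y) = winProb F Q y := by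
  have hle (y : I) : winProb F Q y ≤ 1 := by
    rw [← winProb_one (F := F) (Q := Q)]
    exact hQ.strictMono_winProb.monotone y.2.2
  set E : I → I := fun y => ⟨winProb F Q y, (winProb_pos _).le, hle y⟩
  have hE : StrictMono E := fun a b hab => hQ.strictMono_winProb hab
  have hsurj (u : I) : E (Function.invFun E (max u (E 0))) = max u (E 0) := by
    refine Function.invFun_eq ?_
    obtain ⟨t, ht, htu⟩ := intermediate_value_Icc zero_le_one hQ.continuous_winProb.continuousOn
      (show ((max u (E 0) : I) : ℝ) ∈ Icc (winProb F Q 0) (winProb F Q 1) from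
        ⟨show E 0 ≤ max u (E 0) from le_max_right _ _, by rw [winProb_one]; exact (max u (E 0)).2.2⟩)
    exact ⟨⟨t, ht⟩, Subtype.ext htu⟩
  set g : I → I := fun u => Q (Function.invFun E (max u (E 0)))
  have hg : Monotone g := by
    intro a b hab
    refine Q.strictMono.monotone (hE.le_iff_le.1 ?_)
    rw [hsurj, hsurj]
    exact max_le_max_right _ hab
  obtain ⟨H, hH⟩ : ∃ H : ProbabilityMeasure I, (H : Measure I) = (volume : Measure I).map g :=
    ⟨⟨_, Measure.isProbabilityMeasure_map hg.measurable.aemeasurable⟩, rfl⟩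
  refine ⟨H, fun y => ?_⟩
  rw [cdf_eq_measureReal, hH]
  change ((volume : Measure I).map g).real (Iic (Q y)) = _
  have hpre : g ⁻¹' Iic (Q y) = Iic (E y) := by
    ext u
    simp only [g, mem_preimage, mem_Iic]
    rw [Q.strictMono.le_iff_le, ← hE.le_iff_le, hsurj, max_le_iff]
    exact and_iff_left (hE.monotone y.2.1)
  rw [map_measureReal_apply hg.measurable measurableSet_Iic, hpre, measureReal_def,
    unitInterval.volume_Iic, ENNReal.toReal_ofReal (E y).2.1]

variable {H : ProbabilityMeasure I}

theorem IsOptimalQuantile.isOptimalCompetingBid (hQ : IsOptimalQuantile F Q)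
    (hH : ∀ y : I, cdf H (Q y) = winProb F Q y) : IsOptimalCompetingBid F Q H := by
  intro x hx
  obtain ⟨y, rfl⟩ := QuantileStrategy.exists_eq hQ.zero hx
  rw [hH, Function.leftInverse_invFun Q.strictMono.injective y, winProb,
    intervalIntegral.integral_symm]
  rfl

theorem IsOptimalQuantile.sub_mul_cdf_le (hQ : IsOptimalQuantile F Q)
    (hH : ∀ y : I, cdf H (Q y) = winProb F Q y) (y b : I) :
    (quantile F y - b) * cdf H b ≤ (quantile F y - Q y) * cdf H (Q y) := by
  have key (z : I) : (quantile F y - Q z) * cdf H (Q z) ≤ (quantile F y - Q y) * cdf H (Q y) := by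
    simpa only [hH] using hQ.sub_mul_winProb_le y z
  rcases le_total b (Q 1) with hb | hb
  · obtain ⟨z, rfl⟩ := QuantileStrategy.exists_eq hQ.zero hb
    exact key z
  -- The bid Q(1) already wins with certainty, so bidding more only costs more.
  · have h1 : cdf H (Q 1) = 1 := by rw [hH, Icc.coe_one, winProb_one]
    have hb' : (Q 1 : ℝ) ≤ b := hb
    have h2 : cdf H b = 1 := le_antisymm (cdf_le_one' H b) (h1 ▸ monotone_cdf' H hb')
    refine le_trans ?_ (key 1)
    rw [h1, h2]
    linarith

theorem IsOptimalQuantile.expectedUtility_le (hQ : IsOptimalQuantile F Q)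
    (hH : ∀ y : I, cdf H (Q y) = winProb F Q y) (s : Strategy) :
    expectedUtility F s H ≤ expectedUtility F (Q.toStrategy F) H := by
  have hm : Measurable fun p : I × I => ((p.1 : ℝ) - p.2) * cdf H p.2 :=
    Measurable.mul (by fun_prop) ((measurable_cdf H).comp (by fun_prop))
  have hb (v b : I) : |((v : ℝ) - b) * cdf H b| ≤ 1 := by
    rw [abs_mul, abs_of_nonneg (cdf_nonneg' H _)]
    have : |(v : ℝ) - b| ≤ 1 := by
      rw [abs_le]; constructor <;> linarith [v.2.1, v.2.2, b.2.1, b.2.2]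
    exact mul_le_one₀ this (cdf_nonneg' H _) (cdf_le_one' H _)
  have hgm : Measurable fun v : I => ∫ b : I, ((v : ℝ) - b) * cdf H b ∂(s.1 v) :=
    (StronglyMeasurable.integral_kernel_prod_right' (κ := s.1) hm.stronglyMeasurable).measurable
  rw [expectedUtility_eq_integral_cdf, integral_quantileI F hgm, expectedUtility_toStrategy]
  refine integral_mono (Integrable.of_bound
      (hgm.comp (measurable_quantileI F)).aestronglyMeasurable 1 (Eventually.of_forall fun y => ?_))
    (Integrable.of_bound (hm.comp ((measurable_quantileI F).prodMk
      Q.measurable)).aestronglyMeasurable 1 (Eventually.of_forall fun y => hb (quantileI F y) (Q y)))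
    fun y => ?_
  · have h' := norm_integral_le_of_norm_le_const (μ := s.1 (quantileI F y)) (C := 1)
      (f := fun b : I => ((quantileI F y : ℝ) - b) * cdf H b)
      (Eventually.of_forall fun b => hb _ b)
    simpa using h'
  · have h' := integral_mono (μ := s.1 (quantileI F y))
      (f := fun b : I => ((quantileI F y : ℝ) - b) * cdf H b)
      (Integrable.of_bound (hm.comp (measurable_const.prodMk measurable_id)).aestronglyMeasurable 1
        (Eventually.of_forall fun b => hb _ b))
      (integrable_const ((quantile F y - Q y) * cdf H (Q y)))
      fun b => hQ.sub_mul_cdf_le hH y b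
    simpa using h'

/-! ### Saddle point and minimax value -/

theorem IsOptimalQuantile.mixedRegret_le (hQ : IsOptimalQuantile F Q)
    (hH : ∀ y : I, cdf H (Q y) = winProb F Q y) (s : Strategy) :
    mixedRegret F (Q.toStrategy F) (diracMixture H) ≤ mixedRegret F s (diracMixture H) := by
  rw [mixedRegret_diracMixture_eq, mixedRegret_diracMixture_eq]
  exact sub_le_sub_left (hQ.expectedUtility_le hH s) _

/-- H is concentrated on [0, Q 1], where the regret against δ_h is constant. -/
theorem IsOptimalQuantile.mixedRegret_eq (hQ : IsOptimalQuantile F Q)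
    (hH : ∀ y : I, cdf H (Q y) = winProb F Q y) :
    mixedRegret F (Q.toStrategy F) (diracMixture H) = ∫ t in (0 : ℝ)..1, extend Q t := by
  have h1 : (H : Measure I).real (Iic (Q 1)) = 1 :=
    (cdf_eq_measureReal H (Q 1)).symm.trans (by rw [hH, Icc.coe_one, winProb_one])
  have h2 : ∀ᵐ h ∂(H : Measure I), h ≤ Q 1 := by
    rw [measureReal_def, ENNReal.toReal_eq_one_iff] at h1
    exact (prob_compl_eq_zero_iff measurableSet_Iic).2 h1
  rw [mixedRegret_diracMixture,
    integral_congr_ae (h2.mono fun h hh => hQ.regret_diracProba_eq hh)]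
  simp

theorem IsOptimalQuantile.mixedRegret_le_mixedRegret (hQ : IsOptimalQuantile F Q)
    (hH : ∀ y : I, cdf H (Q y) = winProb F Q y) (𝓗 : ProbabilityMeasure (ProbabilityMeasure I)) :
    mixedRegret F (Q.toStrategy F) 𝓗 ≤ mixedRegret F (Q.toStrategy F) (diracMixture H) := by
  rw [hQ.mixedRegret_eq hH]
  -- Nonnegativity of the smaller integrand replaces its integrability, so `regret` need not be
  -- measurable in H'.
  have := integral_mono_of_nonneg (μ := (𝓗 : Measure (ProbabilityMeasure I)))
    (Eventually.of_forall fun H' => regret_nonneg F (Q.toStrategy F) H')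
    (integrable_const (∫ t in (0 : ℝ)..1, extend Q t))
    (Eventually.of_forall fun H' => hQ.regret_le H')
  simpa [mixedRegret] using this

theorem IsOptimalQuantile.worstRegret_eq (hQ : IsOptimalQuantile F Q)
    (hH : ∀ y : I, cdf H (Q y) = winProb F Q y) :
    worstRegret F (Q.toStrategy F) = mixedRegret F (Q.toStrategy F) (diracMixture H) := by
  have : Nonempty (ProbabilityMeasure I) := ⟨H⟩
  refine le_antisymm (ciSup_le fun H' => ?_) (mixedRegret_diracMixture_le_worstRegret F _ H)
  rw [hQ.mixedRegret_eq hH]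
  exact hQ.regret_le H'

theorem IsOptimalQuantile.isMinimaxOptimal (hQ : IsOptimalQuantile F Q)
    (hH : ∀ y : I, cdf H (Q y) = winProb F Q y) : IsMinimaxOptimal F (Q.toStrategy F) := fun s => by
  rw [hQ.worstRegret_eq hH]
  exact (hQ.mixedRegret_le hH s).trans (mixedRegret_diracMixture_le_worstRegret F s H)

theorem IsOptimalQuantile.iInf_worstRegret (hQ : IsOptimalQuantile F Q)
    (hH : ∀ y : I, cdf H (Q y) = winProb F Q y) :
    ⨅ s : Strategy, worstRegret F s = mixedRegret F (Q.toStrategy F) (diracMixture H) := by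
  have : Nonempty Strategy := ⟨Q.toStrategy F⟩
  rw [← hQ.worstRegret_eq hH]
  exact le_antisymm (ciInf_le (bddBelow_worstRegret F) _)
    (le_ciInf fun s => hQ.isMinimaxOptimal hH s)

/-! ### The integral equation `z y = ∫ t in 0..y, (p t - ψ (z t))` -/

/-- A function that expands distances by at least ε is strictly increasing and unbounded in both
directions; its inverse contracts them by 1/ε. -/
theorem exists_inverse_of_mul_sub_le {Γ : ℝ → ℝ} {ε : ℝ} (hε : 0 < ε) (hc : Continuous Γ)
    (hΓ : ∀ a b, a ≤ b → ε * (b - a) ≤ Γ b - Γ a) :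
    ∃ φ : ℝ → ℝ, (∀ z, Γ (φ z) = z) ∧ (∀ x, φ (Γ x) = x) ∧ Monotone φ ∧
      LipschitzWith (Real.toNNReal ε⁻¹) φ := by
  have hmono : StrictMono Γ := fun a b hab => by
    have := hΓ a b hab.le
    nlinarith [mul_pos hε (sub_pos.2 hab)]
  have htop : Tendsto Γ atTop atTop := by
    refine tendsto_atTop_mono' _ ?_ (tendsto_atTop_add_const_right _ (Γ 0)
      (tendsto_id.const_mul_atTop hε))
    filter_upwards [eventually_ge_atTop 0] with x hx
    have := hΓ 0 x hx
    simp only [id, sub_zero] at *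
    linarith
  have hbot : Tendsto Γ atBot atBot := by
    refine tendsto_atBot_mono' _ ?_ (tendsto_atBot_add_const_right _ (Γ 0)
      (tendsto_id.const_mul_atBot hε))
    filter_upwards [eventually_le_atBot 0] with x hx
    have := hΓ x 0 hx
    simp only [id, zero_sub] at *
    linarith
  have hr := Function.rightInverse_surjInv (hc.surjective htop hbot)
  set φ := Function.surjInv (hc.surjective htop hbot)
  have hφ : Monotone φ := fun a b hab => hmono.le_iff_le.1 (by rwa [hr, hr])
  refine ⟨φ, hr, fun x => hmono.injective (hr _), hφ, ?_⟩
  have key (a b : ℝ) (hab : a ≤ b) : dist (φ a) (φ b) ≤ ε⁻¹ * dist a b := by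
    have := hΓ (φ a) (φ b) (hφ hab)
    rw [hr, hr] at this
    rw [dist_comm, dist_comm a, Real.dist_eq, Real.dist_eq, abs_of_nonneg (sub_nonneg.2 (hφ hab)),
      abs_of_nonneg (sub_nonneg.2 hab), inv_mul_eq_div, le_div_iff₀ hε]
    linarith
  refine LipschitzWith.of_dist_le_mul fun a b => ?_
  rw [Real.coe_toNNReal _ (inv_nonneg.2 hε.le)]
  rcases le_total a b with hab | hab
  · exact key a b hab
  · rw [dist_comm, dist_comm a]
    exact key b a hab

/-- Since p may jump, Picard-Lindelöf is applied to α = z - ∫ p, which solves α' = -ψ(α + ∫ p) with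
a continuous right-hand side. That side is bounded by 1, so a ball of radius 1 suffices for the
whole unit interval. -/
theorem exists_integral_equation {p ψ : ℝ → ℝ} {K : NNReal} (hp : Monotone p)
    (hψ : LipschitzWith K ψ) (hψ1 : ∀ x, ψ x ∈ Icc (0 : ℝ) 1) :
    ∃ z : ℝ → ℝ, ContinuousOn z (Icc 0 1) ∧
      ∀ y ∈ Icc (0 : ℝ) 1, z y = ∫ t in (0 : ℝ)..y, (p t - ψ (z t)) := by
  set P : ℝ → ℝ := fun y => ∫ t in (0 : ℝ)..y, p t
  have hP : Continuous P :=
    intervalIntegral.continuous_primitive (fun _ _ => hp.intervalIntegrable) 0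
  have hpl : IsPicardLindelof (fun t w => -ψ (w + P t)) (⟨0, by simp⟩ : Icc (0 : ℝ) 1) (0 : ℝ)
      1 0 1 K := by
    refine ⟨fun t _ => LipschitzWith.lipschitzOnWith ?_, fun x _ => ?_, fun t _ x _ => ?_, by simp⟩
    · refine LipschitzWith.of_dist_le_mul fun a b => ?_
      rw [dist_neg_neg]
      simpa using hψ.dist_le_mul (a + P t) (b + P t)
    · exact (hψ.continuous.comp (continuous_const.add hP)).neg.continuousOn
    · rw [norm_neg, Real.norm_eq_abs, abs_of_nonneg (hψ1 _).1]
      exact (hψ1 _).2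
  obtain ⟨α, hα0, hα⟩ := hpl.exists_eq_forall_mem_Icc_hasDerivWithinAt₀
  have hαc : ContinuousOn α (Icc 0 1) := fun t ht => (hα t ht).continuousWithinAt
  have hcont : ContinuousOn (fun t => ψ (α t + P t)) (Icc 0 1) :=
    hψ.continuous.comp_continuousOn (hαc.add hP.continuousOn)
  refine ⟨fun t => α t + P t, hαc.add hP.continuousOn, fun y hy => ?_⟩
  have hsub : Icc 0 y ⊆ Icc (0 : ℝ) 1 := Icc_subset_Icc_right hy.2
  have hint : IntervalIntegrable (fun t => ψ (α t + P t)) volume 0 y :=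
    (hcont.mono hsub).intervalIntegrable_of_Icc hy.1
  have h1 := intervalIntegral.integral_eq_sub_of_hasDerivAt_of_le hy.1 (hαc.mono hsub)
    (fun t ht => (hα t (hsub (Ioo_subset_Icc_self ht))).hasDerivAt
      (Icc_mem_nhds ht.1 (ht.2.trans_le hy.2))) hint.neg
  rw [intervalIntegral.integral_neg] at h1
  rw [intervalIntegral.integral_sub hp.intervalIntegrable hint]
  simp only [hα0] at h1
  linarith

/-- `z` is a continuous solution of the integral equation with a monotone inhomogeneity `p` and a
continuous monotone nonlinearity `ψ`. -/
structure IsIntegralSolution (p ψ z : ℝ → ℝ) : Prop where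
  monotone_left : Monotone p
  continuous_right : Continuous ψ
  monotone_right : Monotone ψ
  continuousOn : ContinuousOn z (Icc 0 1)
  eq_integral : ∀ y ∈ Icc (0 : ℝ) 1, z y = ∫ t in (0 : ℝ)..y, (p t - ψ (z t))

namespace IsIntegralSolution

variable {p ψ z : ℝ → ℝ}

theorem continuousOn_comp (h : IsIntegralSolution p ψ z) :
    ContinuousOn (fun t => ψ (z t)) (Icc 0 1) :=
  h.continuous_right.comp_continuousOn h.continuousOn

theorem intervalIntegrable_comp (h : IsIntegralSolution p ψ z) {a b : ℝ}
    (ha : a ∈ Icc (0 : ℝ) 1) (hb : b ∈ Icc (0 : ℝ) 1) :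
    IntervalIntegrable (fun t => ψ (z t)) volume a b :=
  (h.continuousOn_comp.mono (uIcc_subset_Icc ha hb)).intervalIntegrable

theorem intervalIntegrable (h : IsIntegralSolution p ψ z) {a b : ℝ} (ha : a ∈ Icc (0 : ℝ) 1)
    (hb : b ∈ Icc (0 : ℝ) 1) : IntervalIntegrable (fun t => p t - ψ (z t)) volume a b :=
  h.monotone_left.intervalIntegrable.sub (h.intervalIntegrable_comp ha hb)

theorem sub_eq_integral (h : IsIntegralSolution p ψ z) {a b : ℝ} (ha : a ∈ Icc (0 : ℝ) 1)
    (hb : b ∈ Icc (0 : ℝ) 1) : z b - z a = ∫ t in a..b, (p t - ψ (z t)) := by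
  rw [h.eq_integral a ha, h.eq_integral b hb]
  exact intervalIntegral.integral_interval_sub_left (h.intervalIntegrable (by simp) hb)
    (h.intervalIntegrable (by simp) ha)

theorem zero (h : IsIntegralSolution p ψ z) : z 0 = 0 := by
  rw [h.eq_integral 0 (by simp), intervalIntegral.integral_same]

/-- After the last time a ≤ y with ψ(z) ≤ p(y), ψ(z) would exceed p, so z could not rise from a to
y; then ψ(z(y)) ≤ ψ(z(a)) ≤ p(y). -/
theorem comp_le (h : IsIntegralSolution p ψ z) (h0 : ψ 0 ≤ p 0) {y : ℝ}
    (hy : y ∈ Icc (0 : ℝ) 1) : ψ (z y) ≤ p y := by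
  by_contra! hlt
  have hsub : Icc 0 y ⊆ Icc (0 : ℝ) 1 := Icc_subset_Icc_right hy.2
  have hA : IsCompact {t | t ∈ Icc 0 y ∧ ψ (z t) ≤ p y} :=
    isCompact_Icc.of_isClosed_subset
      ((h.continuousOn_comp.mono hsub).preimage_isClosed_of_isClosed isClosed_Icc isClosed_Iic)
      fun t ht => ht.1
  obtain ⟨a, ha, hmax⟩ := hA.exists_isGreatest
    ⟨0, ⟨le_rfl, hy.1⟩, by rw [h.zero]; exact h0.trans (h.monotone_left hy.1)⟩
  have hle : z y - z a ≤ 0 := by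
    rw [h.sub_eq_integral (hsub ha.1) hy]
    refine (intervalIntegral.integral_mono_on_of_le_Ioo ha.1.2
      (h.intervalIntegrable (hsub ha.1) hy) (intervalIntegrable_const (c := (0 : ℝ)))
      fun t ht => ?_).trans (by simp)
    have h1 : p y < ψ (z t) := by
      by_contra! h2
      exact absurd (hmax ⟨⟨ha.1.1.trans ht.1.le, ht.2.le⟩, h2⟩) (not_le.2 ht.1)
    linarith [h.monotone_left ht.2.le]
  linarith [h.monotone_right (sub_nonpos.1 hle), ha.2]

theorem monotoneOn (h : IsIntegralSolution p ψ z) (h0 : ψ 0 ≤ p 0) : MonotoneOn z (Icc 0 1) := by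
  intro a ha b hb hab
  rw [← sub_nonneg, h.sub_eq_integral ha hb]
  exact intervalIntegral.integral_nonneg hab fun t ht =>
    sub_nonneg.2 (h.comp_le h0 ⟨ha.1.trans ht.1, ht.2.trans hb.2⟩)

/-- Let b be the first time ψ(z) reaches p(y). Just before b the slope of z is at most ψ(z(b)) -
ψ(z), hence at most K times the remaining increase of z. On a short interval this Grönwall-type
bound forces z to be constant, giving an earlier contact. -/
theorem comp_lt (h : IsIntegralSolution p ψ z) {K : NNReal} (hK : LipschitzWith K ψ)
    (h0 : ψ 0 ≤ 0) (hp0 : 0 ≤ p 0) (hp : ∀ y ∈ Ioc (0 : ℝ) 1, 0 < p y) {y : ℝ}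
    (hy : y ∈ Ioc (0 : ℝ) 1) : ψ (z y) < p y := by
  by_contra! hle
  have hsub : Icc 0 y ⊆ Icc (0 : ℝ) 1 := Icc_subset_Icc_right hy.2
  have hA : IsCompact {t | t ∈ Icc 0 y ∧ p y ≤ ψ (z t)} :=
    isCompact_Icc.of_isClosed_subset
      ((h.continuousOn_comp.mono hsub).preimage_isClosed_of_isClosed isClosed_Icc isClosed_Ici)
      fun t ht => ht.1
  obtain ⟨b, hb, hmin⟩ := hA.exists_isLeast ⟨y, ⟨hy.1.le, le_rfl⟩, hle⟩
  have hb0 : 0 < b := by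
    refine lt_of_le_of_ne hb.1.1 fun hb0 => ?_
    have := hb.2
    rw [← hb0, h.zero] at this
    linarith [hp y hy]
  -- The length 1/(K + 1) makes K (b - s) < 1; the minimum with b keeps s ≥ 0.
  set s := b - min b (1 / (K + 1 : ℝ)) with hs
  have hm0 : 0 < min b (1 / (K + 1 : ℝ)) := lt_min hb0 (by positivity)
  have hs0 : 0 ≤ s := sub_nonneg.2 (min_le_left _ _)
  have hsb : s < b := by linarith
  have hsy : s ∈ Icc 0 y := ⟨hs0, hsb.le.trans hb.1.2⟩
  have hmono := h.monotoneOn (h0.trans hp0)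
  have hbound : z b - z s ≤ (b - s) * (K * (z b - z s)) := by
    have hI : ∫ t in s..b, (p t - ψ (z t)) ≤ ∫ _ in s..b, (K * (z b - z s) : ℝ) := by
      refine intervalIntegral.integral_mono_on hsb.le
        (h.intervalIntegrable (hsub hsy) (hsub hb.1)) intervalIntegrable_const fun t ht => ?_
      have ht1 : t ∈ Icc (0 : ℝ) 1 := hsub ⟨hs0.trans ht.1, ht.2.trans hb.1.2⟩
      have h1 : p t ≤ ψ (z b) := (h.monotone_left (ht.2.trans hb.1.2)).trans hb.2
      have h2 : z t ≤ z b := hmono ht1 (hsub hb.1) ht.2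
      have h3 : z s ≤ z t := hmono (hsub hsy) ht1 ht.1
      have h4 : ψ (z b) - ψ (z t) ≤ K * (z b - z t) := by
        have := hK.dist_le_mul (z b) (z t)
        rw [Real.dist_eq, Real.dist_eq, abs_of_nonneg (sub_nonneg.2 h2)] at this
        exact (le_abs_self _).trans this
      have h5 : (K : ℝ) * (z b - z t) ≤ K * (z b - z s) :=
        mul_le_mul_of_nonneg_left (by linarith) K.2
      linarith
    rwa [← h.sub_eq_integral (hsub hsy) (hsub hb.1), intervalIntegral.integral_const,
      smul_eq_mul] at hI
  have hlt1 : (b - s) * K < 1 := by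
    have h1 : b - s ≤ 1 / (K + 1 : ℝ) := by
      rw [hs, sub_sub_cancel]; exact min_le_right _ _
    calc (b - s) * K ≤ 1 / (K + 1 : ℝ) * K := mul_le_mul_of_nonneg_right h1 K.2
      _ < 1 := by
        rw [one_div, inv_mul_eq_div, div_lt_one (by positivity)]
        linarith
  have hzle : z b ≤ z s := by nlinarith
  exact absurd (hmin ⟨hsy, hb.2.trans (h.monotone_right hzle)⟩) (not_le.2 hsb)

theorem strictMonoOn (h : IsIntegralSolution p ψ z) (hlt : ∀ y ∈ Ioc (0 : ℝ) 1, ψ (z y) < p y) :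
    StrictMonoOn z (Icc 0 1) := by
  intro a ha b hb hab
  rw [← sub_pos, h.sub_eq_integral ha hb]
  exact intervalIntegral.intervalIntegral_pos_of_pos_on (h.intervalIntegrable ha hb)
    (fun t ht => sub_pos.2 (hlt t ⟨ha.1.trans_lt ht.1, (ht.2.trans_le hb.2).le⟩)) hab

theorem hasDerivAt (h : IsIntegralSolution p ψ z) {t : ℝ} (ht : t ∈ Ioo (0 : ℝ) 1)
    (hp : ContinuousAt p t) : HasDerivAt z (p t - ψ (z t)) t := by
  have hnhds : Icc (0 : ℝ) 1 ∈ 𝓝 t := Icc_mem_nhds ht.1 ht.2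
  have hmeas : StronglyMeasurableAtFilter (fun t => p t - ψ (z t)) (𝓝 t) :=
    ⟨Icc 0 1, hnhds, h.monotone_left.measurable.aestronglyMeasurable.sub
      (h.continuousOn_comp.aestronglyMeasurable measurableSet_Icc)⟩
  refine (intervalIntegral.integral_hasDerivAt_right
    (h.intervalIntegrable (left_mem_Icc.2 zero_le_one) (Ioo_subset_Icc_self ht)) hmeas
    (hp.sub (h.continuousOn_comp.continuousAt hnhds))).congr_of_eventuallyEq ?_
  filter_upwards [hnhds] with y hy using h.eq_integral y hy

end IsIntegralSolution

/-! ### Existence of the optimal quantile-based strategy -/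

/-- The integral of `1 - min F c` from `0` to `x`. -/
def cappedSurplus (F : ProbabilityMeasure I) (c x : ℝ) : ℝ :=
  ∫ t in (0 : ℝ)..x, (1 - min (cdf F t) c)

theorem monotone_min_cdf (F : ProbabilityMeasure I) (c : ℝ) :
    Monotone fun t => min (cdf F t) c :=
  (monotone_cdf' F).min monotone_const

theorem intervalIntegrable_capped (F : ProbabilityMeasure I) (c a b : ℝ) :
    IntervalIntegrable (fun t => 1 - min (cdf F t) c) volume a b :=
  intervalIntegrable_const.sub (monotone_min_cdf F c).intervalIntegrable

theorem cappedSurplus_sub (F : ProbabilityMeasure I) (c a b : ℝ) :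
    cappedSurplus F c b - cappedSurplus F c a = ∫ t in a..b, (1 - min (cdf F t) c) :=
  intervalIntegral.integral_interval_sub_left (intervalIntegrable_capped F c 0 b)
    (intervalIntegrable_capped F c 0 a)

theorem continuous_cappedSurplus (F : ProbabilityMeasure I) (c : ℝ) :
    Continuous (cappedSurplus F c) :=
  intervalIntegral.continuous_primitive (fun a b => intervalIntegrable_capped F c a b) 0

theorem mul_sub_le_cappedSurplus_sub (F : ProbabilityMeasure I) (c a b : ℝ) (hab : a ≤ b) :
    (1 - c) * (b - a) ≤ cappedSurplus F c b - cappedSurplus F c a := by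
  rw [cappedSurplus_sub]
  have := intervalIntegral.integral_mono_on hab (intervalIntegrable_const (c := 1 - c))
    (intervalIntegrable_capped F c a b) fun t _ => by linarith [min_le_right (cdf F t) c]
  rwa [intervalIntegral.integral_const, smul_eq_mul, mul_comm] at this

theorem cappedSurplus_le (F : ProbabilityMeasure I) {c x : ℝ} (hc : 0 ≤ c) (hx : 0 ≤ x) :
    cappedSurplus F c x ≤ x := by
  have := intervalIntegral.integral_mono_on hx (intervalIntegrable_capped F c 0 x)
    (intervalIntegrable_const (c := (1 : ℝ)))
    fun t _ => by linarith [le_min (cdf_nonneg' F t) hc]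
  simpa [cappedSurplus] using this

theorem surplus_le_cappedSurplus (F : ProbabilityMeasure I) (c : ℝ) {x : ℝ} (hx : 0 ≤ x) :
    surplus F x ≤ cappedSurplus F c x :=
  intervalIntegral.integral_mono_on hx (intervalIntegrable_one_sub_cdf F 0 x)
    (intervalIntegrable_capped F c 0 x) fun t _ => by linarith [min_le_left (cdf F t) c]

theorem hasDerivAt_cappedSurplus (F : ProbabilityMeasure I) (c : ℝ) {x : ℝ}
    (hx : ContinuousAt (cdf F) x) :
    HasDerivAt (cappedSurplus F c) (1 - min (cdf F x) c) x :=
  intervalIntegral.integral_hasDerivAt_right (intervalIntegrable_capped F c 0 x)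
    ((measurable_const.sub
      (monotone_min_cdf F c).measurable).stronglyMeasurable.stronglyMeasurableAtFilter)
    (continuousAt_const.sub (hx.min continuousAt_const))

theorem surplus_one_pos {F : ProbabilityMeasure I} (hF : (F : Measure I) {0} = 0) :
    0 < surplus F 1 := by
  rw [← integral_quantile]
  exact intervalIntegral.intervalIntegral_pos_of_pos_on
    (intervalIntegrable_quantile F (by simp) (by simp))
    (fun t ht => quantile_pos hF ht.1 ht.2.le) zero_lt_one

theorem surplus_one_le_one (F : ProbabilityMeasure I) : surplus F 1 ≤ 1 :=
  (surplus_le_cappedSurplus F 0 zero_le_one).trans (cappedSurplus_le F le_rfl zero_le_one)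

theorem cdf_lt_one_of_surplus_lt (F : ProbabilityMeasure I) {x : ℝ}
    (hx : x ≤ 1) (h : surplus F x < surplus F 1) : cdf F x < 1 := by
  by_contra! hle
  have h0 : ∫ t in x..1, (1 - cdf F t) = 0 := by
    refine (intervalIntegral.integral_congr (g := fun _ => (0 : ℝ)) fun t ht => ?_).trans (by simp)
    rw [uIcc_of_le hx] at ht
    exact sub_eq_zero.2 (le_antisymm (hle.trans (monotone_cdf' F ht.1)) (cdf_le_one' F t))
  rw [← surplus_sub_surplus] at h0
  linarith

theorem extend_of_mem (Q : I → I) {t : ℝ} (ht : t ∈ Icc (0 : ℝ) 1) : extend Q t = Q ⟨t, ht⟩ := by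
  rw [extend, projIcc_of_mem]

theorem extend_quantileI (F : ProbabilityMeasure I) {t : ℝ} (ht : t ∈ Icc (0 : ℝ) 1) :
    extend (quantileI F) t = quantile F t := by
  rw [extend_of_mem _ ht]
  rfl

theorem monotone_extend_quantileI (F : ProbabilityMeasure I) : Monotone (extend (quantileI F)) :=
  fun _ _ h => monotone_quantileI F (monotone_projIcc _ h)

/-- A solution `z` of `z' = F⁻ - ψ ∘ z` with `ψ` at least the identity on its range stays away from
its upper bound. -/
theorem IsIntegralSolution.add_sq_div_le {p ψ z : ℝ → ℝ} (h : IsIntegralSolution p ψ z)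
    {m : ℝ} (hm0 : 0 < m) (hm1 : m ≤ 1) (hm : ∫ t in (0 : ℝ)..1, p t = m) (hp1 : ∀ t, p t ≤ 1)
    (hψ0 : ∀ x, 0 ≤ ψ x) (hψz : ∀ t ∈ Icc (0 : ℝ) 1, z t ≤ ψ (z t)) :
    z 1 + (m / 2) ^ 2 / (1 + m / 2) ≤ m := by
  have h1 : (1 : ℝ) ∈ Icc (0 : ℝ) 1 := by simp
  have h0 : (0 : ℝ) ∈ Icc (0 : ℝ) 1 := by simp
  have ha : 1 - m / 2 ∈ Icc (0 : ℝ) 1 := ⟨by linarith, by linarith⟩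
  have hz1 : z 1 = m - ∫ t in (0 : ℝ)..1, ψ (z t) := by
    rw [h.eq_integral 1 h1, intervalIntegral.integral_sub h.monotone_left.intervalIntegrable
      (h.intervalIntegrable_comp h0 h1), hm]
  have hlow : ∀ t ∈ Icc (1 - m / 2) 1, z 1 - m / 2 ≤ ψ (z t) := by
    intro t ht
    have ht' : t ∈ Icc (0 : ℝ) 1 := ⟨ha.1.trans ht.1, ht.2⟩
    have hle := intervalIntegral.integral_mono_on ht.2 (h.intervalIntegrable ht' h1)
      (intervalIntegrable_const (c := (1 : ℝ))) fun s _ => by linarith [hp1 s, hψ0 (z s)]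
    rw [← h.sub_eq_integral ht' h1] at hle
    simp only [intervalIntegral.integral_const, smul_eq_mul, mul_one] at hle
    linarith [hψz t ht', ht.1]
  have hI2 := intervalIntegral.integral_mono_on ha.2 (intervalIntegrable_const (c := z 1 - m / 2))
    (h.intervalIntegrable_comp ha h1) hlow
  have hI1 : 0 ≤ ∫ t in (0 : ℝ)..(1 - m / 2), ψ (z t) :=
    intervalIntegral.integral_nonneg ha.1 fun t _ => hψ0 _
  have hadd := intervalIntegral.integral_add_adjacent_intervals (h.intervalIntegrable_comp h0 ha)
    (h.intervalIntegrable_comp ha h1)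
  simp only [intervalIntegral.integral_const, smul_eq_mul] at hI2
  -- With D = m - z(1) = ∫ ψ(z), the last stretch of length m/2 gives D ≥ (m/2)(m/2 - D); solving
  -- for D yields the gap.
  have hfin : (m / 2) ^ 2 / (1 + m / 2) ≤ m - z 1 := by
    rw [div_le_iff₀ (by linarith)]
    nlinarith
  linarith

theorem exists_isOptimalQuantile {F : ProbabilityMeasure I} (hF : (F : Measure I) {0} = 0) :
    ∃ Q : QuantileStrategy, IsOptimalQuantile F Q := by
  set m := surplus F 1 with hm
  have hm0 : 0 < m := surplus_one_pos hF
  have hm1 : m ≤ 1 := surplus_one_le_one F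
  set δ := (m / 2) ^ 2 / (1 + m / 2) with hδ
  have hδ0 : 0 < δ := by positivity
  have hδm : δ ≤ m := by
    rw [hδ, div_le_iff₀ (by linarith)]
    nlinarith
  obtain ⟨x₀, hx₀, hx₀m⟩ : ∃ x₀ ∈ Icc (0 : ℝ) 1, surplus F x₀ = m - δ :=
    intermediate_value_Icc zero_le_one (continuous_surplus F).continuousOn
      ⟨by rw [surplus, intervalIntegral.integral_same]; linarith, by linarith⟩
  -- The cap is the CDF at the point where the surplus equals the a priori bound m - δ on z(1).
  -- Below x₀ capping changes nothing, and c < 1 because surplus remains beyond x₀.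
  set c := cdf F x₀
  have hc1 : c < 1 := cdf_lt_one_of_surplus_lt F hx₀.2 (by linarith)
  have hc0 : 0 ≤ c := cdf_nonneg' F x₀
  set Γ := cappedSurplus F c
  have hΓ0 : Γ 0 = 0 := intervalIntegral.integral_same
  obtain ⟨φ, (hΓφ : ∀ z, Γ (φ z) = z), (hφΓ : ∀ x, φ (Γ x) = x), hφm, hφL⟩ :=
    exists_inverse_of_mul_sub_le (sub_pos.2 hc1)
      (continuous_cappedSurplus F c) (mul_sub_le_cappedSurplus_sub F c)
  have hφ0 : φ 0 = 0 := by simpa only [hΓ0] using hφΓ 0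
  -- Clipping φ to [0,1] supplies the global bound needed for Picard-Lindelöf; `hψφ` shows that it
  -- is inactive along the solution.
  set ψ : ℝ → ℝ := fun x => max 0 (min 1 (φ x)) with hψ
  have hψL : LipschitzWith (Real.toNNReal (1 - c)⁻¹) ψ := (hφL.const_min 1).const_max 0
  have hψ1 : ∀ x, ψ x ∈ Icc (0 : ℝ) 1 := fun x =>
    ⟨le_max_left _ _, max_le zero_le_one (min_le_left _ _)⟩
  have hψ0 : ψ 0 = 0 := by simp [hψ, hφ0]
  -- `quantile` drops to 0 beyond 1, as the infimum of the empty set; the constant extension is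
  -- monotone on the whole line.
  set p := extend (quantileI F)
  have hpq : ∀ t ∈ Icc (0 : ℝ) 1, p t = quantile F t := fun t ht => extend_quantileI F ht
  have hp0 : p 0 = 0 := by rw [hpq 0 (by simp), quantile_zero]
  have hpint : ∀ y ∈ Icc (0 : ℝ) 1, ∫ t in (0 : ℝ)..y, p t = ∫ t in (0 : ℝ)..y, quantile F t :=
    fun y hy => intervalIntegral.integral_congr fun t ht =>
      hpq t (uIcc_subset_Icc (by simp) hy ht)
  obtain ⟨z, hzc, hz⟩ := exists_integral_equation (monotone_extend_quantileI F) hψL hψ1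
  have h : IsIntegralSolution p ψ z :=
    ⟨monotone_extend_quantileI F, hψL.continuous,
      fun a b hab => max_le_max_left _ (min_le_min_left _ (hφm hab)), hzc, hz⟩
  have hp_pos : ∀ y ∈ Ioc (0 : ℝ) 1, 0 < p y := fun y hy => by
    rw [hpq y (Ioc_subset_Icc_self hy)]
    exact quantile_pos hF hy.1 hy.2
  have hlt : ∀ y ∈ Ioc (0 : ℝ) 1, ψ (z y) < p y := fun y hy =>
    h.comp_lt hψL hψ0.le hp0.ge hp_pos hy
  have hzmono : StrictMonoOn z (Icc 0 1) := h.strictMonoOn hlt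
  have hz0 : ∀ y ∈ Icc (0 : ℝ) 1, 0 ≤ z y := fun y hy =>
    h.zero ▸ hzmono.monotoneOn (by simp) hy hy.1
  have hpm : ∫ t in (0 : ℝ)..1, p t = m := by
    rw [hpint 1 (by simp), integral_quantile]
  have hzm : ∀ y ∈ Icc (0 : ℝ) 1, z y ≤ m := fun y hy => by
    have h1 := hzmono.monotoneOn hy (by simp) hy.2
    have h2 : z 1 ≤ m := by
      rw [h.eq_integral 1 (by simp), ← hpm]
      exact intervalIntegral.integral_mono_on zero_le_one (h.intervalIntegrable (by simp) (by simp))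
        h.monotone_left.intervalIntegrable fun t _ => by linarith [(hψ1 (z t)).1]
    exact h1.trans h2
  have hψφ : ∀ y ∈ Icc (0 : ℝ) 1, ψ (z y) = φ (z y) := fun y hy => by
    have h1 : 0 ≤ φ (z y) := hφ0 ▸ hφm (hz0 y hy)
    have h2 : φ (z y) ≤ 1 := by
      rw [← hφΓ 1]
      exact hφm ((hzm y hy).trans (surplus_le_cappedSurplus F c zero_le_one))
    simp only [hψ]
    rw [min_eq_right h2, max_eq_right h1]
  have hΓψ : ∀ y ∈ Icc (0 : ℝ) 1, Γ (ψ (z y)) = z y := fun y hy => by rw [hψφ y hy, hΓφ]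
  have hψz : ∀ y ∈ Icc (0 : ℝ) 1, z y ≤ ψ (z y) := fun y hy => by
    have := cappedSurplus_le F hc0 (hψ1 (z y)).1
    rwa [show cappedSurplus F c (ψ (z y)) = z y from hΓψ y hy] at this
  -- The a priori bound gives z(1) ≤ m - δ = S(x₀) ≤ Γ(x₀), so Q stays below x₀ and the capped
  -- equation is the original one.
  have hz1 : z 1 ≤ Γ x₀ := by
    have h1 := h.add_sq_div_le hm0 hm1 hpm (fun t => (quantileI F _).2.2) (fun x => (hψ1 x).1) hψz
    have h2 := surplus_le_cappedSurplus F c hx₀.1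
    linarith
  have hψx₀ : ∀ y ∈ Icc (0 : ℝ) 1, ψ (z y) ≤ x₀ := fun y hy => by
    rw [hψφ y hy, ← hφΓ x₀]
    exact hφm ((hzmono.monotoneOn hy (by simp) hy.2).trans hz1)
  have hmin : ∀ y ∈ Icc (0 : ℝ) 1, min (cdf F (ψ (z y))) c = cdf F (ψ (z y)) := fun y hy =>
    min_eq_left (monotone_cdf' F (hψx₀ y hy))
  set q : I → I := fun y => ⟨ψ (z y), hψ1 _⟩
  have hqext : ∀ t ∈ Icc (0 : ℝ) 1, extend q t = ψ (z t) := fun t ht => by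
    rw [extend_of_mem _ ht]
  have hqmono : StrictMono q := by
    intro a b hab
    have h1 : z a < z b := hzmono a.2 b.2 hab
    refine lt_of_le_of_ne (h.monotone_right h1.le) fun heq => h1.ne ?_
    rw [← hΓψ a a.2, ← hΓψ b b.2]
    exact congrArg (fun x : I => Γ x) heq
  have hzL : LipschitzOnWith 1 z (Icc 0 1) := by
    refine LipschitzOnWith.of_dist_le_mul fun a ha b hb => ?_
    rw [dist_eq_norm, h.sub_eq_integral hb ha, Real.dist_eq]
    refine intervalIntegral.norm_integral_le_of_norm_le_const fun t ht => ?_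
    have h1 : p t ∈ Icc (0 : ℝ) 1 := (quantileI F _).2
    have h2 := hψ1 (z t)
    rw [Real.norm_eq_abs, NNReal.coe_one, abs_le]
    constructor <;> linarith [h1.1, h1.2, h2.1, h2.2]
  have hqac : AbsolutelyContinuousOnInterval (extend q) 0 1 := by
    refine LipschitzOnWith.absolutelyContinuousOnInterval (K := Real.toNNReal (1 - c)⁻¹ * 1) ?_
    rw [uIcc_of_le zero_le_one]
    intro a ha b hb
    rw [hqext a ha, hqext b hb]
    exact hψL.comp_lipschitzOnWith hzL ha hb
  set Q : QuantileStrategy := ⟨q, hqmono, hqac⟩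
  refine ⟨Q, ?_, ?_, fun y hy => ?_, fun y hy => ?_⟩
  · have hpc : ∀ᵐ t ∂(volume.restrict (Icc (0 : ℝ) 1)), ContinuousAt p t :=
      ae_restrict_of_ae ((h.monotone_left.countable_not_continuousAt.ae_notMem volume).mono
        fun t ht => not_not.1 ht)
    have hIoo : ∀ᵐ t ∂(volume.restrict (Icc (0 : ℝ) 1)), t ∈ Ioo (0 : ℝ) 1 := by
      rw [← restrict_Ioo_eq_restrict_Icc]
      exact ae_restrict_mem measurableSet_Ioo
    filter_upwards [hpc, hIoo, Q.ae_continuousAt (monotone_cdf' F)] with t htp ht htc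
    have htI := Ioo_subset_Icc_self ht
    have hQt : extend Q t = ψ (z t) := hqext t htI
    rw [hQt] at htc ⊢
    have hpos : 0 < 1 - cdf F (ψ (z t)) := by
      linarith [monotone_cdf' F (hψx₀ t htI)]
    have hd : HasDerivAt Γ (1 - cdf F (ψ (z t))) (φ (z t)) := by
      have := hasDerivAt_cappedSurplus F c htc
      rw [hmin t htI] at this
      rwa [← hψφ t htI]
    -- Q = φ ∘ z on [0,1], and the inverse function rule for φ = Γ⁻¹ brings back the denominator 1 -
    -- F(Q).
    have hφd := HasDerivAt.of_local_left_inverse hφL.continuous.continuousAt hd hpos.ne'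
      (Eventually.of_forall hΓφ)
    have hcomp := hφd.comp t (h.hasDerivAt ht htp)
    rw [hpq t htI, inv_mul_eq_div] at hcomp
    refine hcomp.congr_of_eventuallyEq ?_
    filter_upwards [Icc_mem_nhds ht.1 ht.2] with s hs
    exact (hqext s hs).trans (hψφ s hs)
  · refine Subtype.ext ?_
    change ψ (z 0) = 0
    rw [h.zero, hψ0]
  · have h1 : q 0 < q y := hqmono hy
    exact lt_of_le_of_lt (q 0).2.1 h1
  · have := hlt y ⟨hy, y.2.2⟩
    rwa [hpq y y.2] at this

end

end FirstPrice

theorem mainTheorem2 (F : MeasureTheory.ProbabilityMeasure unitInterval)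
    (hF : (F : MeasureTheory.Measure unitInterval) {0} = 0) :
    (∃ Q : FirstPrice.QuantileStrategy, FirstPrice.IsOptimalQuantile F Q) ∧
    ∀ Q : FirstPrice.QuantileStrategy, FirstPrice.IsOptimalQuantile F Q →
      ∃ H : MeasureTheory.ProbabilityMeasure unitInterval,
        FirstPrice.IsOptimalCompetingBid F Q H ∧
        -- saddle point for the partial-information regret
        (∀ s : FirstPrice.Strategy,
          FirstPrice.mixedRegret F (Q.toStrategy F) (FirstPrice.diracMixture H) ≤
            FirstPrice.mixedRegret F s (FirstPrice.diracMixture H)) ∧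
        (∀ H' : MeasureTheory.ProbabilityMeasure unitInterval,
          FirstPrice.regret F (Q.toStrategy F) H' ≤
            FirstPrice.mixedRegret F (Q.toStrategy F) (FirstPrice.diracMixture H)) ∧
        (∀ 𝓗 : MeasureTheory.ProbabilityMeasure (MeasureTheory.ProbabilityMeasure unitInterval),
          FirstPrice.mixedRegret F (Q.toStrategy F) 𝓗 ≤
            FirstPrice.mixedRegret F (Q.toStrategy F) (FirstPrice.diracMixture H)) ∧
        -- the minimax value
        (⨅ s : FirstPrice.Strategy, ⨆ H' : MeasureTheory.ProbabilityMeasure unitInterval,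
          FirstPrice.regret F s H') =
            FirstPrice.mixedRegret F (Q.toStrategy F) (FirstPrice.diracMixture H) ∧
        FirstPrice.mixedRegret F (Q.toStrategy F) (FirstPrice.diracMixture H) =
          ∫ t in (0 : ℝ)..1, FirstPrice.extend Q t ∧
        FirstPrice.IsMinimaxOptimal F (Q.toStrategy F) := by
  refine ⟨FirstPrice.exists_isOptimalQuantile hF, fun Q hQ => ?_⟩
  obtain ⟨H, hH⟩ := hQ.exists_competingBid
  refine ⟨H, hQ.isOptimalCompetingBid hH, hQ.mixedRegret_le hH, fun H' => ?_,
    hQ.mixedRegret_le_mixedRegret hH, hQ.iInf_worstRegret hH, hQ.mixedRegret_eq hH,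
    hQ.isMinimaxOptimal hH⟩
  rw [hQ.mixedRegret_eq hH]
  exact hQ.regret_le H'
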